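/- **Setting.** Consider a time-varying linear system $x_{t+1}=A_tx_t+B_tu_t+w_t$ with $x_t\in\mathbb R^{n}$, $u_t\in\mathbb R^{m}$ and initial state $x_1=w_0$ (for instance $w_0=0$), stage costs $c_t:\mathbb R^{n}\times\mathbb R^{m}\to\mathbb R$, and a given sequence of matrices $K_t$. Norms are Euclidean and spectral. For a horizon $T$ assume: * $\|w_t\|\le W$ for $0\le t\le T$, and $\|B_t\|\le C_B$, $\|K_t\|\le\kappa$ for $1\le t\le T$; * $K_{1:T}$ is $(\kappa,\delta)$ sequentially stabilizing: $\big\|\prod_{t=s}^{r}(A_t+B_tK_t)\big\|<\kappa(1-\delta)^{s-r+1}$ for all $1\le r\le s\le T$, where $0<\delta<1$; * for $1\le t\le T$, $c_t$ is differentiable, $\alpha$-strongly convex ($\alpha>0$), and $\|\nabla c_t(x,u)\|\le L\max\{1,\|x\|+\|u\|\}$ for all $x,u$. Let $x^{\rm nat}_{t+1}=\sum_{i=0}^{t}\big(\prod_{j=0}^{i-1}(A_{t-j}+B_{t-j}K_{t-j})\big)w_{t-i}$ for $t\ge0$ and $x^{\rm nat}_s=0$ for $s\le0$. For $M=(M^{[1]},\dots,M^{[H]})\in(\mathbb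 R^{m\times n})^H$, disturbance response control with parameters $M_t$ plays $u_t=K_tx_t+\sum_{i=0}^{H-1}M_t^{[i+1]}x^{\rm nat}_{t-i}$. Let $\mathcal M=\{M:\sum_{i=1}^H\|M^{[i]}\|\le\gamma\}$; the policy class $\Pi_{\rm DRC}$ consists of these controls with $M_t=M$ constant, $M\in\mathcal M$. **Losses.** For $t>H$ let $\hat x_t$ be the state reached at time $t$ from state $0$ at time $t-H$ under the dynamics with the controls $K_s\hat x_s+\sum_iM_s^{[i+1]}x^{\rm nat}_{s-i}$, $t-H\le s<t$; for $t\le H$ let $\hat x_t=x_t$. Put $f_t(M_{t-H},\dots,M_t)=c_t\big(\hat x_t,\,K_t\hat x_t+\sum_iM_t^{[i+1]}x^{\rm nat}_{t-i}\big)$ and $\tilde f_t(M)=f_t(M,\dots,M)=c_t(Y_tM+\zeta_t)$, where $Y_t$ is the linear part of the affine map from $M$ to the pair at which $c_t$ is evaluated. **DRC-ONS.** Start from any $M_1\in\mathcal M$ (with $M_t=M_1$ for $t<1$) and play the control above with $M_t$, updated by Semi-ONS with step size $\eta$ and regularization $\lambda$: with $\Lambda_t=\lambda I+\sum_{s=1}^{t}Y_s^{\top}Y_s$,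 $$M_{t+1}=\arg\min_{M\in\mathcal M}\big\langle M-\tilde M_{t+1},\Lambda_t(M-\tilde M_{t+1})\big\rangle,\qquad \tilde M_{t+1}=M_t-\eta\Lambda_t^{-1}\nabla\tilde f_t(M_t),$$ in the Euclidean (Frobenius) structure of the parameter space. **Theorem.** There is an absolute $k\in\mathbb N$ such that for all $n,m,W,\kappa,\delta,C_B,\gamma,\alpha,L$ and all $\eta\ge1/\alpha$, $\lambda>0$, $b$ there is a constant $C$, depending only on these quantities, such that the following holds for all $T\ge2$, all memory lengths $H$ with $\tfrac1\delta\log T\le H\le b\log T$, and all systems, disturbances, costs and $K_t$ satisfying the assumptions above. Let $(x_t,u_t)$ and $M_t$ be the states, controls and parameters of DRC-ONS. Then $$\sum_{t=1}^{T}c_t(x_t,u_t)-\min_{\pi\in\Pi_{\rm DRC}}\sum_{t=1}^{T}c_t(x^\pi_t,u^\pi_t)\le C(\log T)^k$$ and the stability gap satisfies $$\sum_{t=1}^{T}\big|f_t(M_{t-H},\dots,M_t)-\tilde f_t(M_t)\big|\le C(\log T)^k.$$ -/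

import Mathlib

/-- The Euclidean space `ℝⁿ`. Matrices are represented by the continuous linear maps between these
spaces, whose norm is the spectral norm. -/
abbrev Vec (n : ℕ) : Type := EuclideanSpace ℝ (Fin n)

/-- Pairs `(x, u)` of a state and a control, with the Euclidean norm of `ℝⁿ⁺ᵐ`. -/
abbrev StateControl (n m : ℕ) : Type := WithLp 2 (Vec n × Vec m)

/-- Parameters `M = (M^[1], …, M^[H])` of `m × n` matrices, with the Euclidean (Frobenius) structure.
The entry `M (i, a, b)` is the entry `(a, b)` of the matrix `M^[i+1]`. -/
abbrev DRCParam (n m H : ℕ) : Type := EuclideanSpace ℝ (Fin H × Fin m × Fin n)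

namespace DRCParam

variable {n m H : ℕ}

/-- The matrix `M^[i+1]`. -/
noncomputable def block (M : DRCParam n m H) (i : Fin H) : Vec n →L[ℝ] Vec m :=
  LinearMap.toContinuousLinearMap (Matrix.toEuclideanLin (Matrix.of fun a b => M (i, a, b)))

theorem block_add (M N : DRCParam n m H) (i : Fin H) : (M + N).block i = M.block i + N.block i := by
  have h : (Matrix.of fun a b => (M + N) (i, a, b))
      = (Matrix.of fun a b => M (i, a, b)) + Matrix.of fun a b => N (i, a, b) := by
    ext a b; simp
  simp only [block, h, map_add]

theorem block_smul (r : ℝ) (M : DRCParam n m H) (i : Fin H) : (r • M).block i = r • M.block i := by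
  have h : (Matrix.of fun a b => (r • M) (i, a, b)) = r • Matrix.of fun a b => M (i, a, b) := by
    ext a b; simp
  simp only [block, h, map_smul]

/-- The parameters with `∑ᵢ ‖M^[i]‖ ≤ γ` (spectral norms). -/
def constraintSet (n m H : ℕ) (γ : ℝ) : Set (DRCParam n m H) :=
  {M | ∑ i, ‖M.block i‖ ≤ γ}

end DRCParam

/-- The data of an online control problem `x_{t+1} = A_t x_t + B_t u_t + w_t` with costs `c_t` and a
sequence of linear controllers `K_t`. Times are `1, 2, …`; the vector `w 0` is the initial state
`x_1`. -/
structure LTVProblem (n m : ℕ) where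
  A : ℕ → Vec n →L[ℝ] Vec n
  B : ℕ → Vec m →L[ℝ] Vec n
  K : ℕ → Vec n →L[ℝ] Vec m
  w : ℕ → Vec n
  c : ℕ → StateControl n m → ℝ

namespace LTVProblem

variable {n m : ℕ} (S : LTVProblem n m)

/-- `A_t + B_t K_t` -/
noncomputable def closedLoop (t : ℕ) : Vec n →L[ℝ] Vec n := S.A t + S.B t ∘L S.K t

/-- `closedLoopProd r k` is the product of `A_t + B_t K_t` over `t = r, …, r + k - 1`, with later
times on the left. -/
noncomputable def closedLoopProd (r : ℕ) : ℕ → (Vec n →L[ℝ] Vec n)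
  | 0 => ContinuousLinearMap.id ℝ (Vec n)
  | k + 1 => S.closedLoop (r + k) ∘L closedLoopProd r k

/-- The sequence `K_t` is `(κ, δ)` sequentially stabilizing: over every nonempty interval
`{r, …, r + k - 1} ⊆ {1, …, T}` the product of `A_t + B_t K_t` has norm less than `κ (1 - δ) ^ k`. -/
def SeqStabilizing (T : ℕ) (κ δ : ℝ) : Prop :=
  ∀ r k : ℕ, 1 ≤ r → 1 ≤ k → r + k ≤ T + 1 → ‖S.closedLoopProd r k‖ < κ * (1 - δ) ^ k

/-- Nature's state `x^nat_{t+1} = ∑_{i=0}^{t} (∏_{j<i} (A_{t-j} + B_{t-j} K_{t-j})) w_{t-i}`, written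
as a recursion; it vanishes before time `1`. -/
noncomputable def xnat : ℕ → Vec n
  | 0 => 0
  | t + 1 => S.closedLoop t (xnat t) + S.w t

variable {H : ℕ}

/-- The linear map `M ↦ ∑_{i=0}^{H-1} M^[i+1] x^nat_{t-i}`, with `x^nat_s = 0` for `s ≤ 0`. -/
noncomputable def response (H t : ℕ) : DRCParam n m H →L[ℝ] Vec m :=
  LinearMap.toContinuousLinearMap
    { toFun := fun M => ∑ i : Fin H, M.block i (S.xnat (t - i))
      map_add' := fun M N => by
        simp [DRCParam.block_add, Finset.sum_add_distrib]
      map_smul' := fun r M => by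
        simp [DRCParam.block_smul, Finset.smul_sum] }

/-- The disturbance response control `u_t = K_t x_t + ∑_{i=0}^{H-1} M^[i+1] x^nat_{t-i}`. -/
noncomputable def control (t : ℕ) (x : Vec n) (M : DRCParam n m H) : Vec m :=
  S.K t x + S.response H t M

/-- The state at time `t` of the system that is at `0` at time `r` (and before), and is then driven by
the disturbance response controls with parameter `M s` at time `s`. -/
noncomputable def stateFrom (r : ℕ) (M : ℕ → DRCParam n m H) : ℕ → Vec n
  | 0 => 0
  | t + 1 =>
    if t < r then 0
    else S.A t (stateFrom r M t) + S.B t (S.control t (stateFrom r M t) (M t)) + S.w t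

/-- The state `x_t` under the parameters `M s`, `s < t`. In particular `x_1 = w_0`. -/
noncomputable def state (M : ℕ → DRCParam n m H) (t : ℕ) : Vec n := S.stateFrom 0 M t

/-- The proxy state, which starts at `0` at time `t - H`; for `t ≤ H` it is the state itself. -/
noncomputable def proxyState (M : ℕ → DRCParam n m H) (t : ℕ) : Vec n := S.stateFrom (t - H) M t

/-- The cost `c_t(x_t, u_t)` at time `t` of playing the parameters `M s`. -/
noncomputable def cost (M : ℕ → DRCParam n m H) (t : ℕ) : ℝ :=
  S.c t (WithLp.toLp 2 (S.state M t, S.control t (S.state M t) (M t)))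

/-- The loss with memory `f_t(M_{t-H}, …, M_t)`: the cost at the proxy state. -/
noncomputable def memoryLoss (M : ℕ → DRCParam n m H) (t : ℕ) : ℝ :=
  S.c t (WithLp.toLp 2 (S.proxyState M t, S.control t (S.proxyState M t) (M t)))

/-- The surrogate loss `f̃_t(M) = f_t(M, …, M)`. -/
noncomputable def surrogateLoss (t : ℕ) (M : DRCParam n m H) : ℝ := S.memoryLoss (fun _ => M) t

/-- The linear part of `M ↦ stateFrom r (M, M, …) t`. -/
noncomputable def stateLin (H r : ℕ) : ℕ → (DRCParam n m H →L[ℝ] Vec n)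
  | 0 => 0
  | t + 1 =>
    if t < r then 0
    else S.closedLoop t ∘L stateLin H r t + S.B t ∘L S.response H t

/-- The linear part of the affine map that sends `M` to the pair of proxy state and control at time
`t` at which `surrogateLoss t M` evaluates `c_t`. -/
noncomputable def proxyLin (H t : ℕ) : DRCParam n m H →L[ℝ] StateControl n m :=
  (WithLp.prodContinuousLinearEquiv 2 ℝ (Vec n) (Vec m)).symm.toContinuousLinearMap ∘L
    (S.stateLin H (t - H) t).prod (S.K t ∘L S.stateLin H (t - H) t + S.response H t)

/-- The Semi-ONS preconditioner `Λ_t = lam I + ∑_{s=1}^{t} Y_sᵀ Y_s` with `Y_s = proxyLin H s`. -/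
noncomputable def precond (H : ℕ) (lam : ℝ) (t : ℕ) : DRCParam n m H →L[ℝ] DRCParam n m H :=
  lam • ContinuousLinearMap.id ℝ (DRCParam n m H) +
    ∑ s ∈ Finset.Icc 1 t, ContinuousLinearMap.adjoint (S.proxyLin H s) ∘L S.proxyLin H s

/-- The Newton point `M - η Λ_t⁻¹ ∇f̃_t(M)`. -/
noncomputable def newtonPoint (η lam : ℝ) (t : ℕ) (M : DRCParam n m H) : DRCParam n m H :=
  M - η • (S.precond H lam t).inverse (gradient (S.surrogateLoss t) M)

/-- The Semi-ONS update after round `t`: the projection of the Newton point onto the constraint set,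
in the norm given by `Λ_t`. -/
noncomputable def semiONS (γ η lam : ℝ) (t : ℕ) (M : DRCParam n m H) : DRCParam n m H :=
  Classical.epsilon fun N : DRCParam n m H =>
    N ∈ DRCParam.constraintSet n m H γ ∧
    IsMinOn (fun Z => inner ℝ (Z - S.newtonPoint η lam t M)
        (S.precond H lam t (Z - S.newtonPoint η lam t M)))
      (DRCParam.constraintSet n m H γ) N

/-- The parameters `M_t` played by DRC-ONS with initialization `M₁` (and `M_t = M₁` for `t < 1`). -/
noncomputable def drcONS (γ η lam : ℝ) (M₁ : DRCParam n m H) : ℕ → DRCParam n m H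
  | 0 => M₁
  | t + 1 => if t = 0 then M₁ else S.semiONS γ η lam t (drcONS γ η lam M₁ t)

/-- The stability gap over `{1, …, T}` of an algorithm that plays the parameters `M t`. -/
noncomputable def stabilityGap (T : ℕ) (M : ℕ → DRCParam n m H) : ℝ :=
  ∑ t ∈ Finset.Icc 1 T, |S.memoryLoss M t - S.surrogateLoss t (M t)|

end LTVProblem

/-!
Closed-loop stability makes the memory of the system decay geometrically, so replacing the true
state by the proxy state of the last `H` rounds changes the total cost by `O (T (1 - δ) ^ H)`.
What remains is online learning with memory for the surrogate losses `M ↦ c_t (Y_t M + ζ_t)`.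
These need not be strongly convex in `M`, but strong convexity of `c_t` yields the curvature term
`α / 2 * ‖Y_t (M - N)‖ ^ 2`, which pays for the growth `Y_tᵀ Y_t` of the preconditioner as soon as
`η α ≥ 1`. The regret is then controlled by the leverages `tr (Λ_t⁻¹ Y_tᵀ Y_t)`, whose sum is at
most the telescoping sum `log det Λ_T - log det Λ_0`. The same leverages control the stability
gap: in the norm of `Λ_j`, moving from `M_j` to `M_{j+1}` is a step of size at most `η G` times
the square root of the `j`-th leverage, and `Λ` is increasing, so that `‖Y_s (M_s - M_t)‖` is at
most a sum over the rounds `j` in between of geometric means of the leverages of rounds `s` and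
`j`.
-/

section LogDet

section Matrix

variable {ι : Type*} [Fintype ι] [DecidableEq ι]

theorem det_le_exp_trace_sub_card {D : Matrix ι ι ℝ} (hD : D.PosSemidef) :
    D.det ≤ Real.exp (D.trace - Fintype.card ι) := by
  have htrace : D.trace - Fintype.card ι = ∑ i, (hD.isHermitian.eigenvalues i - 1) := by
    simp [hD.isHermitian.trace_eq_sum_eigenvalues]
  rw [htrace, Real.exp_sum, hD.isHermitian.det_eq_prod_eigenvalues]
  refine Finset.prod_le_prod (fun i _ => hD.eigenvalues_nonneg i) fun i _ => ?_
  simpa using Real.add_one_le_exp (hD.isHermitian.eigenvalues i - 1)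

open scoped MatrixOrder in
theorem det_le_det_mul_exp_trace_inv_mul_sub_card {A C : Matrix ι ι ℝ} (hA : A.PosDef)
    (hC : C.PosSemidef) : C.det ≤ A.det * Real.exp ((A⁻¹ * C).trace - Fintype.card ι) := by
  obtain ⟨P, hP⟩ := CStarAlgebra.nonneg_iff_eq_star_mul_self.mp hA.inv.posSemidef.nonneg
  rw [Matrix.star_eq_conjTranspose] at hP
  have hdet : (P * C * P.conjTranspose).det = A⁻¹.det * C.det := by
    rw [hP]; simp only [Matrix.det_mul]; ring
  have htrace : (P * C * P.conjTranspose).trace = (A⁻¹ * C).trace := by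
    rw [hP, Matrix.trace_mul_comm, Matrix.mul_assoc]
  calc C.det = A.det * (P * C * P.conjTranspose).det := by
        rw [hdet, ← mul_assoc, ← Matrix.det_mul,
          Matrix.mul_nonsing_inv _ hA.det_pos.ne'.isUnit, Matrix.det_one, one_mul]
    _ ≤ A.det * Real.exp ((A⁻¹ * C).trace - Fintype.card ι) := by
        rw [← htrace]
        exact mul_le_mul_of_nonneg_left
          (det_le_exp_trace_sub_card (hC.mul_mul_conjTranspose_same P)) hA.det_pos.le

end Matrix

variable {E : Type*} [NormedAddCommGroup E] [InnerProductSpace ℝ E] {A C : E →L[ℝ] E}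

theorem posDef_toMatrix_of_isPositive_of_isInvertible (hA : A.IsPositive) (hAinv : A.IsInvertible)
    {ι : Type*} [Fintype ι] [DecidableEq ι] (b : OrthonormalBasis ι ℝ E) :
    (LinearMap.toMatrix b.toBasis b.toBasis A.toLinearMap).PosDef := by
  obtain ⟨e, rfl⟩ := hAinv
  refine ((LinearMap.posSemidef_toMatrix_iff b).2 hA.toLinearMap).posDef_iff_isUnit.2 ?_
  exact (Matrix.isUnit_iff_isUnit_det _).2 (LinearEquiv.isUnit_det e.toLinearEquiv _ _)

variable [FiniteDimensional ℝ E]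

theorem det_pos_of_isPositive_of_isInvertible (hA : A.IsPositive) (hAinv : A.IsInvertible) :
    0 < A.det := by
  simpa [ContinuousLinearMap.det] using
    (posDef_toMatrix_of_isPositive_of_isInvertible hA hAinv (stdOrthonormalBasis ℝ E)).det_pos

theorem log_det_sub_log_det_le_trace (hA : A.IsPositive) (hAinv : A.IsInvertible)
    (hC : C.IsPositive) (hCinv : C.IsInvertible) :
    Real.log C.det - Real.log A.det ≤
      LinearMap.trace ℝ E (A.inverse ∘L C : E →L[ℝ] E) - Module.finrank ℝ E := by
  let b := stdOrthonormalBasis ℝ E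
  let f : (E →ₗ[ℝ] E) → Matrix _ _ ℝ := LinearMap.toMatrix b.toBasis b.toBasis
  have hinv : (f A)⁻¹ = f A.inverse := by
    refine Matrix.inv_eq_left_inv ?_
    rw [← LinearMap.toMatrix_comp, ← ContinuousLinearMap.toLinearMap_comp, hAinv.inverse_comp_self]
    exact LinearMap.toMatrix_id _
  have htrace : ((f A)⁻¹ * f C).trace = LinearMap.trace ℝ E (A.inverse ∘L C : E →L[ℝ] E) := by
    rw [hinv, ← LinearMap.toMatrix_comp, ← ContinuousLinearMap.toLinearMap_comp,
      LinearMap.trace_eq_matrix_trace ℝ b.toBasis]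
  have hdet := det_le_det_mul_exp_trace_inv_mul_sub_card
    (posDef_toMatrix_of_isPositive_of_isInvertible hA hAinv b)
    ((LinearMap.posSemidef_toMatrix_iff b).2 hC.toLinearMap)
  rw [htrace, LinearMap.det_toMatrix, LinearMap.det_toMatrix, Fintype.card_fin] at hdet
  have hlog := Real.log_le_log (det_pos_of_isPositive_of_isInvertible hC hCinv) hdet
  rw [Real.log_mul (det_pos_of_isPositive_of_isInvertible hA hAinv).ne' (Real.exp_ne_zero _),
    Real.log_exp] at hlog
  exact sub_le_iff_le_add'.2 hlog

theorem det_le_pow_finrank (hA : A.IsPositive) {τ : ℝ}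
    (hτ : ∀ v, inner ℝ v (A v) ≤ τ * ‖v‖ ^ 2) : A.det ≤ τ ^ Module.finrank ℝ E := by
  have hsymm := hA.toLinearMap.isSymmetric
  have heigen (i) : hsymm.eigenvalues rfl i ≤ τ := by
    have h := hτ (hsymm.eigenvectorBasis rfl i)
    rw [← A.coe_coe, hsymm.apply_eigenvectorBasis, real_inner_smul_right,
      real_inner_self_eq_norm_sq] at h
    simpa using h
  calc A.det = ∏ i, hsymm.eigenvalues rfl i := hsymm.det_eq_prod_eigenvalues rfl
    _ ≤ ∏ _i : Fin (Module.finrank ℝ E), τ :=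
        Finset.prod_le_prod (fun i _ => hA.toLinearMap.nonneg_eigenvalues rfl i) fun i _ => heigen i
    _ = τ ^ Module.finrank ℝ E := by simp

end LogDet

section Preconditioner

variable {E : Type*} [NormedAddCommGroup E] [InnerProductSpace ℝ E] {P : E →L[ℝ] E}

theorem inner_apply_sq_le_of_isPositive (hP : P.IsPositive) (u v : E) :
    inner ℝ u (P v) ^ 2 ≤ inner ℝ u (P u) * inner ℝ v (P v) := by
  let B : LinearMap.BilinForm ℝ E := (innerₗ E).compl₂ P.toLinearMap
  refine B.apply_sq_le_of_symm (fun v => hP.inner_nonneg_right v) ⟨fun u v => ?_⟩ u v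
  change inner ℝ u (P v) = inner ℝ v (P u)
  rw [← hP.inner_left_eq_inner_right, real_inner_comm]

theorem isPositive_inverse (hP : P.IsPositive) (hinv : P.IsInvertible) :
    P.inverse.IsPositive := by
  have hinner (u v : E) : inner ℝ (P.inverse u) v = inner ℝ (P.inverse u) (P (P.inverse v)) := by
    rw [hinv.self_apply_inverse]
  refine (ContinuousLinearMap.isPositive_iff _).2 ⟨fun u v => ?_, fun v => ?_⟩
  · change inner ℝ (P.inverse u) v = inner ℝ u (P.inverse v)
    rw [hinner, ← hP.inner_left_eq_inner_right, hinv.self_apply_inverse]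
  · rw [hinner]
    exact hP.inner_nonneg_right _

theorem inner_sq_le_inner_inverse_mul_inner (hP : P.IsPositive) (hinv : P.IsInvertible) (u v : E) :
    inner ℝ u v ^ 2 ≤ inner ℝ u (P.inverse u) * inner ℝ v (P v) := by
  have h := inner_apply_sq_le_of_isPositive hP (P.inverse u) v
  rwa [← hP.inner_left_eq_inner_right, hinv.self_apply_inverse, real_inner_comm u] at h

end Preconditioner

section Leverage

variable {E F : Type*} [NormedAddCommGroup E] [InnerProductSpace ℝ E] [FiniteDimensional ℝ E]
  [NormedAddCommGroup F] [InnerProductSpace ℝ F] [FiniteDimensional ℝ F]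

open ContinuousLinearMap (adjoint)

/-- The leverage `tr (P⁻¹ Yᵀ Y)` of an operator `Y` with respect to a preconditioner `P`. For
positive invertible `P` it bounds the squared norm of `Y` when its source is normed by `P`. -/
noncomputable def leverage (P : E →L[ℝ] E) (Y : E →L[ℝ] F) : ℝ :=
  LinearMap.trace ℝ E (P.inverse ∘L (adjoint Y ∘L Y) : E →L[ℝ] E)

theorem leverage_eq_sum {ι : Type*} [Fintype ι] (b : OrthonormalBasis ι ℝ F) (P : E →L[ℝ] E)
    (Y : E →L[ℝ] F) :
    leverage P Y = ∑ k, inner ℝ (adjoint Y (b k)) (P.inverse (adjoint Y (b k))) := by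
  calc leverage P Y = LinearMap.trace ℝ F
        (Y.toLinearMap ∘ₗ (P.inverse.toLinearMap ∘ₗ (adjoint Y).toLinearMap)) := by
        rw [LinearMap.trace_comp_comm']; rfl
    _ = ∑ k, inner ℝ (adjoint Y (b k)) (P.inverse (adjoint Y (b k))) := by
        rw [LinearMap.trace_eq_sum_inner _ b]
        simp [ContinuousLinearMap.adjoint_inner_left]

@[simp]
theorem leverage_zero_right (P : E →L[ℝ] E) : leverage P (0 : E →L[ℝ] F) = 0 := by
  simp [leverage]

section Bounds

variable {P : E →L[ℝ] E} (hP : P.IsPositive) (hinv : P.IsInvertible) (Y : E →L[ℝ] F)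

include hP hinv

theorem leverage_nonneg : 0 ≤ leverage P Y := by
  rw [leverage_eq_sum (stdOrthonormalBasis ℝ F)]
  exact Finset.sum_nonneg fun k _ => (isPositive_inverse hP hinv).inner_nonneg_right _

theorem norm_apply_sq_le_leverage_mul (v : E) :
    ‖Y v‖ ^ 2 ≤ leverage P Y * inner ℝ v (P v) := by
  let b := stdOrthonormalBasis ℝ F
  rw [leverage_eq_sum b, ← b.sum_sq_norm_inner_right, Finset.sum_mul]
  refine Finset.sum_le_sum fun k _ => ?_
  rw [Real.norm_eq_abs, sq_abs, ← ContinuousLinearMap.adjoint_inner_left]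
  exact inner_sq_le_inner_inverse_mul_inner hP hinv _ v

theorem inner_inverse_adjoint_le_mul_leverage (g : F) :
    inner ℝ (adjoint Y g) (P.inverse (adjoint Y g)) ≤ ‖g‖ ^ 2 * leverage P Y := by
  set v := P.inverse (adjoint Y g)
  have hPv : P v = adjoint Y g := hinv.self_apply_inverse _
  have hYv : ‖Y v‖ ^ 2 ≤ leverage P Y * inner ℝ (adjoint Y g) v := by
    simpa only [hPv, real_inner_comm] using norm_apply_sq_le_leverage_mul hP hinv Y v
  have hgv : inner ℝ (adjoint Y g) v ≤ ‖g‖ * ‖Y v‖ := by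
    rw [ContinuousLinearMap.adjoint_inner_left]
    exact real_inner_le_norm _ _
  have h0 : 0 ≤ inner ℝ (adjoint Y g) v := (isPositive_inverse hP hinv).inner_nonneg_right _
  rcases h0.eq_or_lt with h | h
  · rw [← h]
    exact mul_nonneg (sq_nonneg _) (leverage_nonneg hP hinv Y)
  · refine le_of_mul_le_mul_right ?_ h
    calc inner ℝ (adjoint Y g) v * inner ℝ (adjoint Y g) v ≤ (‖g‖ * ‖Y v‖) ^ 2 := by
          rw [← sq]; gcongr
      _ = ‖g‖ ^ 2 * ‖Y v‖ ^ 2 := mul_pow _ _ _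
      _ ≤ ‖g‖ ^ 2 * (leverage P Y * inner ℝ (adjoint Y g) v) := by gcongr
      _ = ‖g‖ ^ 2 * leverage P Y * inner ℝ (adjoint Y g) v := by ring

theorem leverage_add_le_log_det_sub (hinv' : (P + adjoint Y ∘L Y).IsInvertible) :
    leverage (P + adjoint Y ∘L Y) Y ≤
      Real.log (P + adjoint Y ∘L Y).det - Real.log P.det := by
  have hP' : (P + adjoint Y ∘L Y).IsPositive :=
    hP.add (ContinuousLinearMap.isPositive_adjoint_comp_self Y)
  have hlog := log_det_sub_log_det_le_trace hP' hinv' hP hinv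
  have htrace : LinearMap.trace ℝ E ((P + adjoint Y ∘L Y).inverse ∘L P : E →L[ℝ] E) +
      leverage (P + adjoint Y ∘L Y) Y = Module.finrank ℝ E := by
    rw [leverage, ← map_add, ← ContinuousLinearMap.toLinearMap_add, ← ContinuousLinearMap.comp_add,
      hinv'.inverse_comp_self]
    exact LinearMap.trace_id ℝ E
  linarith

end Bounds

section RegGram

/-- The regularized Gram operator `lam I + ∑_{s=1}^{t} Y_sᵀ Y_s` of a sequence of operators, the
preconditioner of online Newton methods. -/
noncomputable def regGram (lam : ℝ) (Y : ℕ → E →L[ℝ] F) (t : ℕ) : E →L[ℝ] E :=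
  lam • ContinuousLinearMap.id ℝ E + ∑ s ∈ Finset.Icc 1 t, adjoint (Y s) ∘L Y s

variable {lam : ℝ} (Y : ℕ → E →L[ℝ] F)

theorem regGram_zero : regGram lam Y 0 = lam • ContinuousLinearMap.id ℝ E := by
  simp [regGram]

theorem regGram_succ (t : ℕ) :
    regGram lam Y (t + 1) = regGram lam Y t + adjoint (Y (t + 1)) ∘L Y (t + 1) := by
  simp only [regGram, Finset.sum_Icc_succ_top (Nat.le_add_left 1 t), add_assoc]

theorem inner_regGram_self (t : ℕ) (v : E) :
    inner ℝ v (regGram lam Y t v) = lam * ‖v‖ ^ 2 + ∑ s ∈ Finset.Icc 1 t, ‖Y s v‖ ^ 2 := by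
  simp only [regGram, add_apply, smul_apply, ContinuousLinearMap.id_apply, sum_apply,
    inner_add_right, inner_sum, real_inner_smul_right, ContinuousLinearMap.comp_apply,
    ContinuousLinearMap.adjoint_inner_right, real_inner_self_eq_norm_sq]

theorem inner_regGram_self_succ (t : ℕ) (v : E) :
    inner ℝ v (regGram lam Y (t + 1) v) = inner ℝ v (regGram lam Y t v) + ‖Y (t + 1) v‖ ^ 2 := by
  simp only [inner_regGram_self, Finset.sum_Icc_succ_top (Nat.le_add_left 1 t), add_assoc]

theorem monotone_inner_regGram_self (v : E) :
    Monotone fun t => inner ℝ v (regGram lam Y t v) :=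
  monotone_nat_of_le_succ fun t => by
    rw [inner_regGram_self_succ]
    exact le_add_of_nonneg_right (sq_nonneg _)

theorem regGram_isPositive (hlam : 0 ≤ lam) (t : ℕ) : (regGram lam Y t).IsPositive :=
  (ContinuousLinearMap.isPositive_id.smul_of_nonneg hlam).add <|
    ContinuousLinearMap.isPositive_sum _ fun s _ =>
      ContinuousLinearMap.isPositive_adjoint_comp_self (Y s)

theorem regGram_isInvertible (hlam : 0 < lam) (t : ℕ) : (regGram lam Y t).IsInvertible := by
  have hinj : Function.Injective (regGram lam Y t).toLinearMap := by
    refine (injective_iff_map_eq_zero _).2 fun v (hv : regGram lam Y t v = 0) => ?_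
    have hle := monotone_inner_regGram_self (lam := lam) Y v (Nat.zero_le t)
    simp only [hv, inner_regGram_self, inner_zero_right] at hle
    simpa [hlam.ne'] using hle.antisymm (by positivity)
  exact ⟨(LinearEquiv.ofInjectiveEndo _ hinj).toContinuousLinearEquiv, by ext v; rfl⟩

theorem sum_leverage_regGram_le_log_det_sub (hlam : 0 < lam) (T : ℕ) :
    ∑ t ∈ Finset.Icc 1 T, leverage (regGram lam Y t) (Y t) ≤
      Real.log (regGram lam Y T).det - Real.log (regGram lam Y 0).det := by
  induction T with
  | zero => simp
  | succ T ih =>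
    have hstep := leverage_add_le_log_det_sub (regGram_isPositive Y hlam.le T)
      (regGram_isInvertible Y hlam T) (Y (T + 1))
      (by rw [← regGram_succ]; exact regGram_isInvertible Y hlam (T + 1))
    rw [← regGram_succ] at hstep
    rw [Finset.sum_Icc_succ_top (Nat.le_add_left 1 T)]
    linarith

theorem det_regGram_le {T : ℕ} {R : ℝ} (hlam : 0 ≤ lam)
    (hY : ∀ t ∈ Finset.Icc 1 T, ‖Y t‖ ≤ R) :
    (regGram lam Y T).det ≤ (lam + T * R ^ 2) ^ Module.finrank ℝ E := by
  refine det_le_pow_finrank (regGram_isPositive Y hlam T) fun v => ?_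
  rw [inner_regGram_self, add_mul]
  gcongr
  calc ∑ t ∈ Finset.Icc 1 T, ‖Y t v‖ ^ 2 ≤ ∑ t ∈ Finset.Icc 1 T, (R * ‖v‖) ^ 2 :=
        Finset.sum_le_sum fun t ht => by gcongr; exact (Y t).le_of_opNorm_le (hY t ht) v
    _ = T * R ^ 2 * ‖v‖ ^ 2 := by simp; ring

theorem sum_leverage_regGram_le (hlam : 0 < lam) {T : ℕ} {R : ℝ}
    (hY : ∀ t ∈ Finset.Icc 1 T, ‖Y t‖ ≤ R) :
    ∑ t ∈ Finset.Icc 1 T, leverage (regGram lam Y t) (Y t) ≤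
      Module.finrank ℝ E * Real.log (1 + T * R ^ 2 / lam) := by
  have hdet0 : (regGram lam Y 0).det = lam ^ Module.finrank ℝ E := by
    rw [regGram_zero, ContinuousLinearMap.det, ContinuousLinearMap.toLinearMap_smul,
      LinearMap.det_smul, ContinuousLinearMap.coe_id, LinearMap.det_id, mul_one]
  have hdetT := Real.log_le_log
    (det_pos_of_isPositive_of_isInvertible (regGram_isPositive Y hlam.le T)
      (regGram_isInvertible Y hlam T)) (det_regGram_le Y hlam.le hY)
  have hratio : 1 + T * R ^ 2 / lam = (lam + T * R ^ 2) / lam := by field_simp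
  calc ∑ t ∈ Finset.Icc 1 T, leverage (regGram lam Y t) (Y t)
      ≤ Real.log ((lam + T * R ^ 2) ^ Module.finrank ℝ E)
          - Real.log (lam ^ Module.finrank ℝ E) := by
        refine (sum_leverage_regGram_le_log_det_sub Y hlam T).trans ?_
        rw [hdet0]
        gcongr
    _ = Module.finrank ℝ E * Real.log (1 + T * R ^ 2 / lam) := by
        rw [hratio, Real.log_div (by positivity) hlam.ne', Real.log_pow, Real.log_pow, mul_sub]

end RegGram

end Leverage

section StrongConvexity

variable {F : Type*} [NormedAddCommGroup F] [InnerProductSpace ℝ F] [CompleteSpace F]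
  {f : F → ℝ}

theorem strongConvexOn_univ_add_inner_gradient_le {α : ℝ} (hf : StrongConvexOn Set.univ α f)
    {x : F} (hx : DifferentiableAt ℝ f x) (y : F) :
    f x + inner ℝ (gradient f x) (y - x) + α / 2 * ‖y - x‖ ^ 2 ≤ f y := by
  have hslope : Filter.Tendsto (fun s : ℝ => s⁻¹ • (f (x + s • (y - x)) - f x))
      (nhdsWithin 0 (Set.Ioi 0)) (nhds (inner ℝ (gradient f x) (y - x))) := by
    rw [inner_gradient_left]
    exact (hx.hasFDerivAt.hasLineDerivAt (y - x)).tendsto_slope_zero_right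
  have hbound : Filter.Tendsto (fun s : ℝ => f y - f x - (1 - s) * (α / 2 * ‖y - x‖ ^ 2))
      (nhdsWithin 0 (Set.Ioi 0)) (nhds (f y - f x - (1 - 0) * (α / 2 * ‖y - x‖ ^ 2))) :=
    ((by fun_prop : Continuous fun s : ℝ =>
      f y - f x - (1 - s) * (α / 2 * ‖y - x‖ ^ 2)).tendsto 0).mono_left nhdsWithin_le_nhds
  have hle := le_of_tendsto_of_tendsto hslope hbound <| by
    filter_upwards [Ioo_mem_nhdsGT one_pos] with s hs
    have hconv := hf.2 (Set.mem_univ y) (Set.mem_univ x) hs.1.le (sub_nonneg.2 hs.2.le)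
      (add_sub_cancel s 1)
    have hpoint : s • y + (1 - s) • x = x + s • (y - x) := by module
    rw [hpoint] at hconv
    simp only [smul_eq_mul] at hconv ⊢
    rw [inv_mul_le_iff₀ hs.1]
    linarith
  linarith

theorem abs_sub_le_mul_of_norm_gradient_le (hf : ConvexOn ℝ Set.univ f)
    (hdiff : Differentiable ℝ f) {G : ℝ} {x y : F} (hx : ‖gradient f x‖ ≤ G)
    (hy : ‖gradient f y‖ ≤ G) : |f x - f y| ≤ G * ‖x - y‖ := by
  have hupper (x y : F) (hx : ‖gradient f x‖ ≤ G) : f x - f y ≤ G * ‖x - y‖ := by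
    have hfirst := strongConvexOn_univ_add_inner_gradient_le (strongConvexOn_zero.2 hf) (hdiff x) y
    have hinner : -(‖gradient f x‖ * ‖y - x‖) ≤ inner ℝ (gradient f x) (y - x) :=
      neg_le_of_abs_le (abs_real_inner_le_norm _ _)
    have hG : ‖gradient f x‖ * ‖y - x‖ ≤ G * ‖y - x‖ := by gcongr
    rw [norm_sub_rev]
    linarith
  have hxy := hupper x y hx
  have hyx := hupper y x hy
  rw [norm_sub_rev] at hyx
  exact abs_sub_le_iff.2 ⟨hxy, hyx⟩

end StrongConvexity

section Projection

variable {E : Type*} [NormedAddCommGroup E] [InnerProductSpace ℝ E] {P : E →L[ℝ] E} {s : Set E}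
  {p N Z : E}

theorem inner_sub_apply_sub_nonneg_of_isMinOn (hP : P.IsPositive) (hs : Convex ℝ s) (hN : N ∈ s)
    (hmin : IsMinOn (fun Z => inner ℝ (Z - p) (P (Z - p))) s N) (hZ : Z ∈ s) :
    0 ≤ inner ℝ (N - p) (P (Z - N)) := by
  have hsymm (u v : E) : inner ℝ u (P v) = inner ℝ v (P u) := by
    rw [← hP.inner_left_eq_inner_right, real_inner_comm]
  have hquad : ∀ r ∈ Set.Ioo (0 : ℝ) 1,
      0 ≤ 2 * inner ℝ (N - p) (P (Z - N)) + r * inner ℝ (Z - N) (P (Z - N)) := fun r hr => by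
    have hle := isMinOn_iff.1 hmin _ (hs.add_smul_sub_mem hN hZ ⟨hr.1.le, hr.2.le⟩)
    rw [add_sub_right_comm] at hle
    simp only [map_add, map_smul, inner_add_left, inner_add_right, real_inner_smul_left,
      real_inner_smul_right, hsymm (Z - N) (N - p)] at hle
    refine nonneg_of_mul_nonneg_right ?_ hr.1
    linarith
  have hlim : Filter.Tendsto
      (fun r : ℝ => 2 * inner ℝ (N - p) (P (Z - N)) + r * inner ℝ (Z - N) (P (Z - N)))
      (nhdsWithin 0 (Set.Ioi 0))
      (nhds (2 * inner ℝ (N - p) (P (Z - N)) + 0 * inner ℝ (Z - N) (P (Z - N)))) :=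
    ((by fun_prop : Continuous fun r : ℝ =>
      2 * inner ℝ (N - p) (P (Z - N)) + r * inner ℝ (Z - N) (P (Z - N))).tendsto 0).mono_left
        nhdsWithin_le_nhds
  have hnonneg := ge_of_tendsto hlim (Filter.mem_of_superset (Ioo_mem_nhdsGT one_pos) hquad)
  linarith

theorem inner_sub_apply_sub_le_of_isMinOn (hP : P.IsPositive) (hs : Convex ℝ s) (hN : N ∈ s)
    (hmin : IsMinOn (fun Z => inner ℝ (Z - p) (P (Z - p))) s N) (hZ : Z ∈ s) :
    inner ℝ (N - Z) (P (N - Z)) ≤ inner ℝ (p - Z) (P (p - Z)) := by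
  have hcross := inner_sub_apply_sub_nonneg_of_isMinOn hP hs hN hmin hZ
  have hsymm : inner ℝ (Z - N) (P (N - p)) = inner ℝ (N - p) (P (Z - N)) := by
    rw [← hP.inner_left_eq_inner_right, real_inner_comm]
  have hpZ : p - Z = -((N - p) + (Z - N)) := by abel
  rw [hpZ, ← neg_sub Z N]
  simp only [map_neg, inner_neg_neg, map_add, inner_add_left, inner_add_right]
  linarith [hP.inner_nonneg_right (N - p)]

end Projection

section OnlineNewton

variable {E F : Type*} [NormedAddCommGroup E] [InnerProductSpace ℝ E] [FiniteDimensional ℝ E]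
  [NormedAddCommGroup F] [InnerProductSpace ℝ F] [FiniteDimensional ℝ F]

open ContinuousLinearMap (adjoint)

/-- The iterates `x` of the online Newton method over rounds `1, …, T` on the set `s`, for losses
whose gradient at `x t` is `Y_tᵀ g_t`: each round takes a Newton step for the preconditioner
`regGram lam Y t` and then projects to `s` in its norm. -/
structure IsOnlineNewton (η lam : ℝ) (s : Set E) (Y : ℕ → E →L[ℝ] F) (g : ℕ → F) (T : ℕ)
    (x : ℕ → E) : Prop where
  convex : Convex ℝ s
  mem : ∀ t, x t ∈ s
  isMinOn : ∀ t ∈ Finset.Icc 1 T, IsMinOn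
    (fun Z => inner ℝ (Z - (x t - η • (regGram lam Y t).inverse (adjoint (Y t) (g t))))
      (regGram lam Y t (Z - (x t - η • (regGram lam Y t).inverse (adjoint (Y t) (g t)))))) s
    (x (t + 1))

namespace IsOnlineNewton

variable {η lam : ℝ} {s : Set E} {Y : ℕ → E →L[ℝ] F} {g : ℕ → F} {T : ℕ} {x : ℕ → E}

theorem step_le (h : IsOnlineNewton η lam s Y g T x) (hlam : 0 < lam) {t : ℕ}
    (ht : t ∈ Finset.Icc 1 T) {Z : E} (hZ : Z ∈ s) :
    inner ℝ (x (t + 1) - Z) (regGram lam Y t (x (t + 1) - Z)) ≤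
      inner ℝ (x t - Z) (regGram lam Y t (x t - Z)) - 2 * η * inner ℝ (g t) (Y t (x t - Z))
        + η ^ 2 * (‖g t‖ ^ 2 * leverage (regGram lam Y t) (Y t)) := by
  have hP := regGram_isPositive Y hlam.le t
  have hinv := regGram_isInvertible Y hlam t
  refine (inner_sub_apply_sub_le_of_isMinOn hP h.convex (h.mem _) (h.isMinOn t ht) hZ).trans ?_
  have hlev := inner_inverse_adjoint_le_mul_leverage hP hinv (Y t) (g t)
  set u := adjoint (Y t) (g t) with hu
  set z := (regGram lam Y t).inverse u
  have hz : regGram lam Y t z = u := hinv.self_apply_inverse u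
  have hcross : inner ℝ z (regGram lam Y t (x t - Z)) = inner ℝ (g t) (Y t (x t - Z)) := by
    rw [← hP.inner_left_eq_inner_right, hz, hu, ContinuousLinearMap.adjoint_inner_left]
  have hcross' : inner ℝ (x t - Z) u = inner ℝ (g t) (Y t (x t - Z)) := by
    rw [real_inner_comm, hu, ContinuousLinearMap.adjoint_inner_left]
  rw [sub_right_comm, map_sub, map_smul, hz]
  simp only [inner_sub_left _ (η • z), inner_sub_right _ _ (η • u), real_inner_smul_left,
    real_inner_smul_right]
  rw [hcross, hcross', real_inner_comm u z]
  linarith [mul_le_mul_of_nonneg_left hlev (sq_nonneg η)]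

theorem potential_add_regret_le (h : IsOnlineNewton η lam s Y g T x) (hlam : 0 < lam) {α : ℝ}
    (hα : 1 ≤ η * α) {Z : E} (hZ : Z ∈ s) {N : ℕ} (hN : N ≤ T) :
    2 * η * ∑ t ∈ Finset.Icc 1 N,
        (inner ℝ (g t) (Y t (x t - Z)) - α / 2 * ‖Y t (x t - Z)‖ ^ 2)
      + inner ℝ (x (N + 1) - Z) (regGram lam Y N (x (N + 1) - Z)) ≤
    lam * ‖x 1 - Z‖ ^ 2 +
      η ^ 2 * ∑ t ∈ Finset.Icc 1 N, ‖g t‖ ^ 2 * leverage (regGram lam Y t) (Y t) := by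
  induction N with
  | zero => simp [inner_regGram_self Y 0 (x 1 - Z), -map_sub]
  | succ N ih =>
    have hprev := ih (by omega)
    have hstep := h.step_le hlam (Finset.mem_Icc.2 ⟨Nat.le_add_left 1 N, hN⟩) hZ
    have hcurv : ‖Y (N + 1) (x (N + 1) - Z)‖ ^ 2 ≤
        η * α * ‖Y (N + 1) (x (N + 1) - Z)‖ ^ 2 := le_mul_of_one_le_left (by positivity) hα
    rw [inner_regGram_self_succ Y N (x (N + 1) - Z)] at hstep
    rw [Finset.sum_Icc_succ_top (Nat.le_add_left 1 N),
      Finset.sum_Icc_succ_top (Nat.le_add_left 1 N)]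
    linarith

theorem regret_le (h : IsOnlineNewton η lam s Y g T x) (hlam : 0 < lam) {α : ℝ} (hη : 0 < η)
    (hα : 1 ≤ η * α) {Z : E} (hZ : Z ∈ s) :
    ∑ t ∈ Finset.Icc 1 T, (inner ℝ (g t) (Y t (x t - Z)) - α / 2 * ‖Y t (x t - Z)‖ ^ 2) ≤
      lam / (2 * η) * ‖x 1 - Z‖ ^ 2 +
        η / 2 * ∑ t ∈ Finset.Icc 1 T, ‖g t‖ ^ 2 * leverage (regGram lam Y t) (Y t) := by
  have hpot := h.potential_add_regret_le hlam hα hZ le_rfl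
  have hnonneg := (regGram_isPositive Y hlam.le T).inner_nonneg_right (x (T + 1) - Z)
  calc _ ≤ (lam * ‖x 1 - Z‖ ^ 2 +
        η ^ 2 * ∑ t ∈ Finset.Icc 1 T, ‖g t‖ ^ 2 * leverage (regGram lam Y t) (Y t)) / (2 * η) := by
        rw [le_div_iff₀ (by positivity)]
        linarith
    _ = _ := by field_simp

theorem norm_apply_step_le (h : IsOnlineNewton η lam s Y g T x) (hlam : 0 < lam) (hη : 0 ≤ η)
    {G : ℝ} {i j : ℕ} (hij : i ≤ j) (hj : j ∈ Finset.Icc 1 T) (hG : ‖g j‖ ≤ G) :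
    ‖Y i (x (j + 1) - x j)‖ ≤
      η * G * (leverage (regGram lam Y i) (Y i) + leverage (regGram lam Y j) (Y j)) := by
  have hG0 : 0 ≤ G := (norm_nonneg _).trans hG
  have hi0 := leverage_nonneg (regGram_isPositive Y hlam.le i) (regGram_isInvertible Y hlam i) (Y i)
  have hj0 := leverage_nonneg (regGram_isPositive Y hlam.le j) (regGram_isInvertible Y hlam j) (Y j)
  have hmove : inner ℝ (x (j + 1) - x j) (regGram lam Y j (x (j + 1) - x j)) ≤
      η ^ 2 * (G ^ 2 * leverage (regGram lam Y j) (Y j)) := by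
    have hstep := h.step_le hlam hj (h.mem j)
    simp only [sub_self, map_zero, inner_zero_right, mul_zero, zero_add] at hstep
    exact hstep.trans (by gcongr)
  refine le_of_sq_le_sq ?_ (by positivity)
  set qi := leverage (regGram lam Y i) (Y i)
  set qj := leverage (regGram lam Y j) (Y j)
  calc ‖Y i (x (j + 1) - x j)‖ ^ 2
      ≤ qi * inner ℝ (x (j + 1) - x j) (regGram lam Y i (x (j + 1) - x j)) :=
        norm_apply_sq_le_leverage_mul (regGram_isPositive Y hlam.le i)
          (regGram_isInvertible Y hlam i) (Y i) _
    _ ≤ qi * (η ^ 2 * (G ^ 2 * qj)) :=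
        mul_le_mul_of_nonneg_left ((monotone_inner_regGram_self Y _ hij).trans hmove) hi0
    _ = (η * G) ^ 2 * (qi * qj) := by ring
    _ ≤ (η * G) ^ 2 * (qi + qj) ^ 2 := by
        gcongr
        nlinarith
    _ = (η * G * (qi + qj)) ^ 2 := by ring

theorem norm_apply_sub_le (h : IsOnlineNewton η lam s Y g T x) (hlam : 0 < lam) (hη : 0 ≤ η)
    {G : ℝ} (hG : ∀ t ∈ Finset.Icc 1 T, ‖g t‖ ≤ G) {i t : ℕ} (hi : 1 ≤ i) (hit : i ≤ t)
    (ht : t ≤ T + 1) :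
    ‖Y i (x i - x t)‖ ≤ η * G * ∑ j ∈ Finset.Ico i t,
      (leverage (regGram lam Y i) (Y i) + leverage (regGram lam Y j) (Y j)) := by
  induction t, hit using Nat.le_induction with
  | base => simp
  | succ t hit ih =>
    have hmem : t ∈ Finset.Icc 1 T := Finset.mem_Icc.2 ⟨by omega, by omega⟩
    rw [Finset.sum_Ico_succ_top hit, mul_add, ← sub_sub_sub_cancel_right _ _ (x t), map_sub]
    exact (norm_sub_le _ _).trans
      (add_le_add (ih (by omega)) (h.norm_apply_step_le hlam hη hit hmem (hG t hmem)))

end IsOnlineNewton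

end OnlineNewton

theorem sum_Icc_sum_Ico_sub_le {q : ℕ → ℝ} (hq : ∀ s, 0 ≤ q s) (H T : ℕ) :
    ∑ t ∈ Finset.Icc 1 T, ∑ s ∈ Finset.Ico (t - H) t, q s ≤ H * ∑ s ∈ Finset.Icc 0 T, q s := by
  rw [Finset.sum_comm' (t' := Finset.Icc 0 T) (s' := fun s => (Finset.Icc 1 T).filter
      fun t => t - H ≤ s ∧ s < t) (by grind), Finset.mul_sum]
  refine Finset.sum_le_sum fun s _ => ?_
  have hsub : ((Finset.Icc 1 T).filter fun t => t - H ≤ s ∧ s < t) ⊆ Finset.Ioc s (s + H) := by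
    intro t ht
    simp only [Finset.mem_filter, Finset.mem_Icc, Finset.mem_Ioc] at ht ⊢
    omega
  have hcard := Finset.card_le_card hsub
  rw [Nat.card_Ioc, Nat.add_sub_cancel_left] at hcard
  rw [Finset.sum_const, nsmul_eq_mul]
  exact mul_le_mul_of_nonneg_right (mod_cast hcard) (hq s)

theorem norm_toLp_two_prod_le {E F : Type*} [SeminormedAddCommGroup E] [SeminormedAddCommGroup F]
    (x : E) (u : F) : ‖WithLp.toLp 2 (x, u)‖ ≤ ‖x‖ + ‖u‖ := by
  refine le_of_sq_le_sq ?_ (by positivity)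
  rw [WithLp.prod_norm_sq_eq_of_L2]
  change ‖x‖ ^ 2 + ‖u‖ ^ 2 ≤ _
  nlinarith [norm_nonneg x, norm_nonneg u]

namespace DRCParam

variable {n m H : ℕ} {γ : ℝ}

theorem block_apply (M : DRCParam n m H) (i : Fin H) (v : Vec n) (a : Fin m) :
    M.block i v a = ∑ b, M (i, a, b) * v b := by
  simp [block, Matrix.toLpLin_apply, Matrix.mulVec, dotProduct]

theorem norm_sq_eq_sum (M : DRCParam n m H) : ‖M‖ ^ 2 = ∑ i, ∑ a, ∑ b, M (i, a, b) ^ 2 := by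
  simp only [EuclideanSpace.real_norm_sq_eq, Fintype.sum_prod_type]

theorem norm_block_le (M : DRCParam n m H) (i : Fin H) : ‖M.block i‖ ≤ ‖M‖ := by
  refine ContinuousLinearMap.opNorm_le_bound _ (norm_nonneg _) fun v => ?_
  refine le_of_sq_le_sq ?_ (by positivity)
  rw [mul_pow, norm_sq_eq_sum, EuclideanSpace.real_norm_sq_eq, EuclideanSpace.real_norm_sq_eq]
  calc ∑ a, (M.block i v) a ^ 2 ≤ ∑ a, (∑ b, M (i, a, b) ^ 2) * ∑ b, v b ^ 2 := by
        refine Finset.sum_le_sum fun a _ => ?_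
        rw [block_apply]
        exact Finset.sum_mul_sq_le_sq_mul_sq _ _ _
    _ = (∑ a, ∑ b, M (i, a, b) ^ 2) * ∑ b, v b ^ 2 := (Finset.sum_mul _ _ _).symm
    _ ≤ (∑ i, ∑ a, ∑ b, M (i, a, b) ^ 2) * ∑ b, v b ^ 2 := by
        gcongr
        exact Finset.single_le_sum (f := fun i => ∑ a, ∑ b, M (i, a, b) ^ 2)
          (fun _ _ => by positivity) (Finset.mem_univ i)

theorem sum_sq_le_mul_norm_block_sq (M : DRCParam n m H) (i : Fin H) :
    ∑ a, ∑ b, M (i, a, b) ^ 2 ≤ n * ‖M.block i‖ ^ 2 := by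
  have hcol (b : Fin n) : ∑ a, M (i, a, b) ^ 2 ≤ ‖M.block i‖ ^ 2 := by
    calc ∑ a, M (i, a, b) ^ 2 = ‖M.block i (EuclideanSpace.single b 1)‖ ^ 2 := by
          simp [EuclideanSpace.real_norm_sq_eq, block_apply]
      _ ≤ ‖M.block i‖ ^ 2 := by
          gcongr
          simpa using (M.block i).le_opNorm (EuclideanSpace.single b 1)
  rw [Finset.sum_comm]
  simpa using Finset.sum_le_card_nsmul Finset.univ _ _ fun b _ => hcol b

theorem norm_sq_le_mul_sum_norm_block_sq (M : DRCParam n m H) :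
    ‖M‖ ^ 2 ≤ n * (∑ i, ‖M.block i‖) ^ 2 := by
  calc ‖M‖ ^ 2 ≤ ∑ i, n * ‖M.block i‖ ^ 2 := by
        rw [norm_sq_eq_sum]
        exact Finset.sum_le_sum fun i _ => M.sum_sq_le_mul_norm_block_sq i
    _ ≤ n * (∑ i, ‖M.block i‖) ^ 2 := by
        rw [← Finset.mul_sum]
        gcongr
        exact Finset.sum_sq_le_sq_sum_of_nonneg fun i _ => norm_nonneg _

theorem nonneg_of_mem_constraintSet {M : DRCParam n m H} (hM : M ∈ constraintSet n m H γ) :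
    0 ≤ γ :=
  (Finset.sum_nonneg fun _ _ => norm_nonneg _).trans hM

theorem norm_sq_le_of_mem_constraintSet {M : DRCParam n m H} (hM : M ∈ constraintSet n m H γ) :
    ‖M‖ ^ 2 ≤ n * γ ^ 2 := by
  refine M.norm_sq_le_mul_sum_norm_block_sq.trans ?_
  gcongr
  exact hM

theorem continuous_block (i : Fin H) : Continuous fun M : DRCParam n m H => M.block i := by
  let blockLin : DRCParam n m H →ₗ[ℝ] (Vec n →L[ℝ] Vec m) :=
    { toFun := fun M => M.block i
      map_add' := fun M N => block_add M N i
      map_smul' := fun r M => block_smul r M i }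
  exact blockLin.continuous_of_finiteDimensional

theorem convex_constraintSet : Convex ℝ (constraintSet n m H γ) := by
  intro M (hM : _ ≤ γ) N (hN : _ ≤ γ) a b ha hb hab
  calc ∑ i, ‖(a • M + b • N).block i‖ ≤ ∑ i, (a * ‖M.block i‖ + b * ‖N.block i‖) := by
        refine Finset.sum_le_sum fun i _ => ?_
        rw [block_add, block_smul, block_smul]
        simpa only [norm_smul, Real.norm_of_nonneg ha, Real.norm_of_nonneg hb] using
          norm_add_le (a • M.block i) (b • N.block i)
    _ = a * ∑ i, ‖M.block i‖ + b * ∑ i, ‖N.block i‖ := by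
        rw [Finset.sum_add_distrib, Finset.mul_sum, Finset.mul_sum]
    _ ≤ a * γ + b * γ := by gcongr
    _ = γ := by rw [← add_mul, hab, one_mul]

theorem isCompact_constraintSet : IsCompact (constraintSet n m H γ) := by
  refine Metric.isCompact_of_isClosed_isBounded ?_ ?_
  · exact isClosed_le (continuous_finsetSum _ fun i _ => (continuous_block i).norm)
      continuous_const
  · refine (Metric.isBounded_closedBall (x := (0 : DRCParam n m H))
      (r := Real.sqrt (n * γ ^ 2))).subset fun M hM => ?_
    rw [mem_closedBall_zero_iff]
    exact Real.le_sqrt_of_sq_le (norm_sq_le_of_mem_constraintSet hM)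

end DRCParam

namespace LTVProblem

variable {n m H : ℕ} (S : LTVProblem n m)

section Recursions

theorem eq_closedLoopProd_of_rec {y : ℕ → Vec n} {r : ℕ}
    (hy : ∀ t, r ≤ t → y (t + 1) = S.closedLoop t (y t)) (k : ℕ) :
    y (r + k) = S.closedLoopProd r k (y r) := by
  induction k with
  | zero => simp [closedLoopProd]
  | succ k ih => rw [← add_assoc, hy _ (by omega), ih]; rfl

theorem eq_sum_closedLoopProd_of_rec {y v : ℕ → Vec n} {r : ℕ} (h0 : y r = 0)
    (hy : ∀ t, r ≤ t → y (t + 1) = S.closedLoop t (y t) + v t) {t : ℕ} (hrt : r ≤ t) :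
    y t = ∑ s ∈ Finset.Ico r t, S.closedLoopProd (s + 1) (t - 1 - s) (v s) := by
  induction t, hrt using Nat.le_induction with
  | base => simp [h0]
  | succ t hrt ih =>
    rw [Finset.sum_Ico_succ_top hrt, hy t hrt, ih, map_sum]
    congr 1
    · refine Finset.sum_congr rfl fun s hs => ?_
      obtain ⟨k, rfl⟩ := Nat.exists_eq_add_of_le (Finset.mem_Ico.1 hs).2
      have hk : s + 1 + k - 1 - s = k := by omega
      have hk' : s + 1 + k + 1 - 1 - s = k + 1 := by omega
      rw [Nat.succ_eq_add_one, hk, hk']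
      rfl
    · simp [closedLoopProd]

theorem response_apply (t : ℕ) (M : DRCParam n m H) :
    S.response H t M = ∑ i : Fin H, M.block i (S.xnat (t - i)) := rfl

theorem response_zero (M : DRCParam n m H) : S.response H 0 M = 0 := by
  simp [response_apply, xnat]

theorem stateFrom_of_le (M : ℕ → DRCParam n m H) {r t : ℕ} (h : t ≤ r) :
    S.stateFrom r M t = 0 := by
  cases t with
  | zero => rfl
  | succ t => exact if_pos h

theorem stateFrom_succ (M : ℕ → DRCParam n m H) {r t : ℕ} (h : r ≤ t) :
    S.stateFrom r M (t + 1) = S.closedLoop t (S.stateFrom r M t)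
      + (S.B t (S.response H t (M t)) + S.w t) := by
  rw [stateFrom, if_neg (not_lt.2 h)]
  simp [closedLoop, control, add_assoc]

theorem stateLin_of_le {r t : ℕ} (h : t ≤ r) : S.stateLin H r t = 0 := by
  cases t with
  | zero => rfl
  | succ t => exact if_pos h

theorem stateLin_succ {r t : ℕ} (h : r ≤ t) (M : DRCParam n m H) :
    S.stateLin H r (t + 1) M
      = S.closedLoop t (S.stateLin H r t M) + S.B t (S.response H t M) := by
  rw [stateLin, if_neg (not_lt.2 h)]
  rfl

theorem stateFrom_const_eq_add_stateLin (r t : ℕ) (M : DRCParam n m H) :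
    S.stateFrom r (fun _ => M) t
      = S.stateFrom r (fun _ => (0 : DRCParam n m H)) t + S.stateLin H r t M := by
  induction t with
  | zero => simp [stateFrom, stateLin]
  | succ t ih =>
    rcases lt_or_ge t r with h | h
    · rw [S.stateFrom_of_le _ h, S.stateFrom_of_le _ h, S.stateLin_of_le h]; simp
    · rw [S.stateFrom_succ _ h, S.stateFrom_succ _ h, S.stateLin_succ h, ih]
      simp only [map_add, map_zero]
      abel

theorem proxyLin_apply (t : ℕ) (M : DRCParam n m H) :
    S.proxyLin H t M = WithLp.toLp 2 (S.stateLin H (t - H) t M,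
      S.K t (S.stateLin H (t - H) t M) + S.response H t M) := rfl

theorem proxyLin_zero : S.proxyLin H 0 = 0 := by
  ext1 M
  rw [proxyLin_apply, S.stateLin_of_le (Nat.zero_le _), response_zero]
  simp

end Recursions

/-- A bound on nature's states of a `(κ, δ)` sequentially stabilized system. -/
noncomputable def natBound (W κ δ : ℝ) : ℝ := (1 + κ) / δ * W

/-- A bound on all states reached with parameters from the constraint set. -/
noncomputable def stateBound (W κ δ C_B γ : ℝ) : ℝ :=
  (1 + κ) / δ * (C_B * (γ * natBound W κ δ) + W)

/-- A bound on `‖proxyLin H t‖ / H`. -/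
noncomputable def linBound (W κ δ C_B : ℝ) : ℝ :=
  (1 + κ) * ((1 + κ) / δ * (C_B * natBound W κ δ)) + natBound W κ δ

/-- The boundedness and stability assumptions on the dynamics over the horizon `T`. -/
structure IsStableOn (T : ℕ) (W κ δ C_B : ℝ) : Prop where
  δ_pos : 0 < δ
  one_le : 1 ≤ T
  norm_w_le : ∀ t ∈ Finset.Icc 0 T, ‖S.w t‖ ≤ W
  norm_B_le : ∀ t ∈ Finset.Icc 1 T, ‖S.B t‖ ≤ C_B
  norm_K_le : ∀ t ∈ Finset.Icc 1 T, ‖S.K t‖ ≤ κ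
  stab : S.SeqStabilizing T κ δ

namespace IsStableOn

variable {S} {T : ℕ} {W κ δ C_B γ : ℝ} (hS : S.IsStableOn T W κ δ C_B)

include hS

theorem W_nonneg : 0 ≤ W := (norm_nonneg _).trans (hS.norm_w_le 0 (by simp))

theorem C_B_nonneg : 0 ≤ C_B := (norm_nonneg _).trans (hS.norm_B_le 1 (by simpa using hS.one_le))

theorem κ_nonneg : 0 ≤ κ := (norm_nonneg _).trans (hS.norm_K_le 1 (by simpa using hS.one_le))

theorem δ_lt_one : δ < 1 := by
  have hprod : 0 < κ * (1 - δ) ^ 1 := (norm_nonneg _).trans_lt <|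
    hS.stab 1 1 le_rfl le_rfl (by linarith [hS.one_le])
  rw [pow_one] at hprod
  linarith [pos_of_mul_pos_right hprod hS.κ_nonneg]

theorem natBound_nonneg : 0 ≤ natBound W κ δ := by
  have := hS.κ_nonneg
  have := hS.δ_pos
  have := hS.W_nonneg
  unfold natBound
  positivity

theorem stateBound_nonneg (hγ : 0 ≤ γ) : 0 ≤ stateBound W κ δ C_B γ := by
  have := hS.κ_nonneg
  have := hS.δ_pos
  have := hS.W_nonneg
  have := hS.C_B_nonneg
  have := hS.natBound_nonneg
  unfold stateBound
  positivity

theorem linBound_nonneg : 0 ≤ linBound W κ δ C_B := by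
  have := hS.κ_nonneg
  have := hS.δ_pos
  have := hS.C_B_nonneg
  have := hS.natBound_nonneg
  unfold linBound
  positivity

theorem norm_closedLoopProd_le {r k : ℕ} (hr : 1 ≤ r) (hrk : r + k ≤ T + 1) :
    ‖S.closedLoopProd r k‖ ≤ (1 + κ) * (1 - δ) ^ k := by
  rcases Nat.eq_zero_or_pos k with rfl | hk
  · refine ContinuousLinearMap.norm_id_le.trans ?_
    simp [hS.κ_nonneg]
  · have hpow : 0 ≤ (1 - δ) ^ k := pow_nonneg (sub_nonneg.2 hS.δ_lt_one.le) k
    linarith [hS.stab r k hr hk hrk]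

theorem norm_le_sum_of_rec {y v : ℕ → Vec n} {r : ℕ} (h0 : y r = 0)
    (hy : ∀ t, r ≤ t → y (t + 1) = S.closedLoop t (y t) + v t) {t : ℕ} (hrt : r ≤ t)
    (ht : t ≤ T + 1) :
    ‖y t‖ ≤ ∑ s ∈ Finset.Ico r t, (1 + κ) * (1 - δ) ^ (t - 1 - s) * ‖v s‖ := by
  rw [S.eq_sum_closedLoopProd_of_rec h0 hy hrt]
  refine norm_sum_le_of_le _ fun s hs => ContinuousLinearMap.le_of_opNorm_le _ ?_ _
  have hst := (Finset.mem_Ico.1 hs).2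
  exact hS.norm_closedLoopProd_le (by omega) (by omega)

theorem norm_le_mul_sum_of_rec {y v : ℕ → Vec n} {r : ℕ} (h0 : y r = 0)
    (hy : ∀ t, r ≤ t → y (t + 1) = S.closedLoop t (y t) + v t) {t : ℕ} (hrt : r ≤ t)
    (ht : t ≤ T + 1) : ‖y t‖ ≤ (1 + κ) * ∑ s ∈ Finset.Ico r t, ‖v s‖ := by
  have hκ := hS.κ_nonneg
  refine (hS.norm_le_sum_of_rec h0 hy hrt ht).trans ?_
  rw [Finset.mul_sum]
  gcongr
  exact mul_le_of_le_one_right (by positivity)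
    (pow_le_one₀ (by linarith [hS.δ_lt_one]) (by linarith [hS.δ_pos]))

theorem sum_Ico_pow_le (r t : ℕ) :
    ∑ s ∈ Finset.Ico r t, (1 - δ) ^ (t - 1 - s) ≤ 1 / δ := by
  have hδ : 0 ≤ 1 - δ := sub_nonneg.2 hS.δ_lt_one.le
  calc ∑ s ∈ Finset.Ico r t, (1 - δ) ^ (t - 1 - s)
      ≤ ∑ s ∈ Finset.range t, (1 - δ) ^ (t - 1 - s) :=
        Finset.sum_le_sum_of_subset_of_nonneg (by grind) fun _ _ _ => by positivity
    _ = ∑ k ∈ Finset.range t, (1 - δ) ^ k := Finset.sum_range_reflect (fun k => (1 - δ) ^ k) t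
    _ ≤ 1 / δ := by
        rw [le_div_iff₀ hS.δ_pos]
        have hgeom := geom_sum_mul_neg (1 - δ) t
        rw [sub_sub_cancel] at hgeom
        linarith [pow_nonneg hδ t]

theorem norm_le_of_rec {y v : ℕ → Vec n} {r : ℕ} (h0 : y r = 0)
    (hy : ∀ t, r ≤ t → y (t + 1) = S.closedLoop t (y t) + v t) {t : ℕ} (hrt : r ≤ t)
    (ht : t ≤ T + 1) {V : ℝ} (hV : 0 ≤ V) (hv : ∀ s < t, ‖v s‖ ≤ V) :
    ‖y t‖ ≤ (1 + κ) / δ * V := by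
  have hκ := hS.κ_nonneg
  have hδ : 0 ≤ 1 - δ := sub_nonneg.2 hS.δ_lt_one.le
  calc ‖y t‖ ≤ ∑ s ∈ Finset.Ico r t, (1 + κ) * (1 - δ) ^ (t - 1 - s) * ‖v s‖ :=
        hS.norm_le_sum_of_rec h0 hy hrt ht
    _ ≤ ∑ s ∈ Finset.Ico r t, (1 + κ) * (1 - δ) ^ (t - 1 - s) * V := by
        gcongr with s hs
        exact hv s (Finset.mem_Ico.1 hs).2
    _ = (1 + κ) * V * ∑ s ∈ Finset.Ico r t, (1 - δ) ^ (t - 1 - s) := by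
        rw [Finset.mul_sum]
        exact Finset.sum_congr rfl fun _ _ => by ring
    _ ≤ (1 + κ) * V * (1 / δ) := by
        gcongr
        exact hS.sum_Ico_pow_le r t
    _ = (1 + κ) / δ * V := by ring

theorem norm_xnat_le {t : ℕ} (ht : t ≤ T + 1) : ‖S.xnat t‖ ≤ natBound W κ δ :=
  hS.norm_le_of_rec (y := S.xnat) (v := S.w) (r := 0) rfl (fun _ _ => rfl) (Nat.zero_le t) ht
    hS.W_nonneg fun s hs => hS.norm_w_le s (by simp; omega)

theorem norm_response_le {t : ℕ} (ht : t ≤ T + 1) (M : DRCParam n m H) :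
    ‖S.response H t M‖ ≤ (∑ i, ‖M.block i‖) * natBound W κ δ := by
  rw [response_apply, Finset.sum_mul]
  refine norm_sum_le_of_le _ fun i _ => (ContinuousLinearMap.le_opNorm _ _).trans ?_
  gcongr
  exact hS.norm_xnat_le (by omega)

theorem norm_response_le_of_mem {t : ℕ} (ht : t ≤ T + 1) {M : DRCParam n m H}
    (hM : M ∈ DRCParam.constraintSet n m H γ) : ‖S.response H t M‖ ≤ γ * natBound W κ δ :=
  (hS.norm_response_le ht M).trans (mul_le_mul_of_nonneg_right hM hS.natBound_nonneg)

theorem norm_response_le_mul_norm {t : ℕ} (ht : t ≤ T + 1) (M : DRCParam n m H) :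
    ‖S.response H t M‖ ≤ natBound W κ δ * (H * ‖M‖) := by
  rw [mul_comm]
  refine (hS.norm_response_le ht M).trans (mul_le_mul_of_nonneg_right ?_ hS.natBound_nonneg)
  simpa using Finset.sum_le_card_nsmul Finset.univ _ _ fun i _ => M.norm_block_le i

theorem norm_B_response_le {t : ℕ} (ht : t ≤ T) (M : DRCParam n m H) :
    ‖S.B t (S.response H t M)‖ ≤ C_B * ‖S.response H t M‖ := by
  rcases Nat.eq_zero_or_pos t with rfl | h
  · simp [response_zero]
  · exact ContinuousLinearMap.le_of_opNorm_le _ (hS.norm_B_le t (Finset.mem_Icc.2 ⟨h, ht⟩)) _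

theorem norm_stateFrom_le {M : ℕ → DRCParam n m H}
    (hM : ∀ t, M t ∈ DRCParam.constraintSet n m H γ) (r : ℕ) {t : ℕ} (ht : t ≤ T + 1) :
    ‖S.stateFrom r M t‖ ≤ stateBound W κ δ C_B γ := by
  have hγ := DRCParam.nonneg_of_mem_constraintSet (hM 0)
  rcases le_total t r with h | h
  · rw [S.stateFrom_of_le _ h, norm_zero]
    exact hS.stateBound_nonneg hγ
  · have hB := hS.C_B_nonneg
    have hW := hS.W_nonneg
    have hnat := hS.natBound_nonneg
    refine hS.norm_le_of_rec (S.stateFrom_of_le M le_rfl) (fun t ht => S.stateFrom_succ M ht) h ht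
      (by positivity) fun s hs => ?_
    refine (norm_add_le _ _).trans (add_le_add ?_ (hS.norm_w_le s (by simp; omega)))
    refine (hS.norm_B_response_le (by omega) _).trans ?_
    gcongr
    exact hS.norm_response_le_of_mem (by omega) (hM s)

theorem norm_stateFrom_sub_le (M N : ℕ → DRCParam n m H) {r t : ℕ} (hrt : r ≤ t)
    (ht : t ≤ T + 1) :
    ‖S.stateFrom r M t - S.stateFrom r N t‖ ≤
      (1 + κ) * ∑ s ∈ Finset.Ico r t, C_B * ‖S.response H s (M s - N s)‖ := by
  have hκ := hS.κ_nonneg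
  calc ‖S.stateFrom r M t - S.stateFrom r N t‖
      ≤ (1 + κ) * ∑ s ∈ Finset.Ico r t, ‖S.B s (S.response H s (M s - N s))‖ := by
        refine hS.norm_le_mul_sum_of_rec (y := fun s => S.stateFrom r M s - S.stateFrom r N s)
          (v := fun s => S.B s (S.response H s (M s - N s))) ?_ (fun s hs => ?_) hrt ht
        · simp only [S.stateFrom_of_le _ le_rfl, sub_self]
        · simp only [S.stateFrom_succ _ hs, map_sub]
          abel
    _ ≤ (1 + κ) * ∑ s ∈ Finset.Ico r t, C_B * ‖S.response H s (M s - N s)‖ := by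
        gcongr with s hs
        exact hS.norm_B_response_le (by have := (Finset.mem_Ico.1 hs).2; omega) _

theorem norm_state_sub_proxyState_le {M : ℕ → DRCParam n m H}
    (hM : ∀ t, M t ∈ DRCParam.constraintSet n m H γ) {t : ℕ} (ht : t ≤ T + 1) :
    ‖S.state M t - S.proxyState M t‖ ≤ (1 + κ) * (1 - δ) ^ H * stateBound W κ δ C_B γ := by
  rw [state, proxyState]
  rcases le_or_gt t H with h | h
  · have := hS.κ_nonneg
    have : 0 ≤ 1 - δ := sub_nonneg.2 hS.δ_lt_one.le
    have := hS.stateBound_nonneg (DRCParam.nonneg_of_mem_constraintSet (hM 0))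
    rw [Nat.sub_eq_zero_of_le h, sub_self, norm_zero]
    positivity
  · have hdecay := S.eq_closedLoopProd_of_rec (r := t - H)
      (y := fun s => S.stateFrom 0 M s - S.stateFrom (t - H) M s) (fun s hs => by
        rw [S.stateFrom_succ M hs, S.stateFrom_succ M (Nat.zero_le s), map_sub]
        abel) H
    simp only [Nat.sub_add_cancel h.le, S.stateFrom_of_le M (le_refl (t - H)), sub_zero] at hdecay
    rw [hdecay]
    exact ContinuousLinearMap.le_of_opNorm_le_of_le _
      (hS.norm_closedLoopProd_le (by omega) (by omega)) (hS.norm_stateFrom_le hM 0 (by omega))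

theorem norm_stateLin_le (r : ℕ) {t : ℕ} (ht : t ≤ T + 1) (M : DRCParam n m H) :
    ‖S.stateLin H r t M‖ ≤ (1 + κ) / δ * (C_B * (natBound W κ δ * (H * ‖M‖))) := by
  have hB := hS.C_B_nonneg
  have hnat := hS.natBound_nonneg
  rcases le_total t r with h | h
  · have := hS.κ_nonneg
    have := hS.δ_pos
    rw [S.stateLin_of_le h, zero_apply, norm_zero]
    positivity
  · refine hS.norm_le_of_rec (y := fun t => S.stateLin H r t M)
      (v := fun t => S.B t (S.response H t M)) (r := r) (by simp [S.stateLin_of_le le_rfl])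
      (fun t ht => S.stateLin_succ ht M) h ht (by positivity) fun s hs => ?_
    refine (hS.norm_B_response_le (by omega) _).trans ?_
    gcongr
    exact hS.norm_response_le_mul_norm (by omega) M

theorem norm_proxyLin_le {t : ℕ} (ht : t ∈ Finset.Icc 1 T) :
    ‖S.proxyLin H t‖ ≤ linBound W κ δ C_B * H := by
  have hκ := hS.κ_nonneg
  have htT : t ≤ T + 1 := (Finset.mem_Icc.1 ht).2.trans T.le_succ
  refine ContinuousLinearMap.opNorm_le_bound _
    (mul_nonneg hS.linBound_nonneg H.cast_nonneg) fun M => ?_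
  have hK := ContinuousLinearMap.le_of_opNorm_le _ (hS.norm_K_le t ht) (S.stateLin H (t - H) t M)
  calc ‖S.proxyLin H t M‖
      ≤ ‖S.stateLin H (t - H) t M‖ + (‖S.K t (S.stateLin H (t - H) t M)‖ + ‖S.response H t M‖) :=
        (norm_toLp_two_prod_le _ _).trans (add_le_add_right (norm_add_le _ _) _)
    _ ≤ (1 + κ) * ‖S.stateLin H (t - H) t M‖ + ‖S.response H t M‖ := by linarith
    _ ≤ (1 + κ) * ((1 + κ) / δ * (C_B * (natBound W κ δ * (H * ‖M‖))))
        + natBound W κ δ * (H * ‖M‖) := by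
        gcongr
        · exact hS.norm_stateLin_le _ htT M
        · exact hS.norm_response_le_mul_norm htT M
    _ = linBound W κ δ C_B * H * ‖M‖ := by rw [linBound]; ring

theorem norm_response_le_mul_norm_proxyLin {t : ℕ} (ht : t ≤ T) (M : DRCParam n m H) :
    ‖S.response H t M‖ ≤ (1 + κ) * ‖S.proxyLin H t M‖ := by
  have hκ := hS.κ_nonneg
  rcases Nat.eq_zero_or_pos t with rfl | hpos
  · rw [response_zero, norm_zero]
    positivity
  · set x := S.stateLin H (t - H) t M
    have hx : ‖x‖ ≤ ‖S.proxyLin H t M‖ := WithLp.norm_fst_le _ (S.proxyLin H t M)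
    have hu : ‖S.K t x + S.response H t M‖ ≤ ‖S.proxyLin H t M‖ :=
      WithLp.norm_snd_le _ (S.proxyLin H t M)
    calc ‖S.response H t M‖ = ‖(S.K t x + S.response H t M) - S.K t x‖ := by
          rw [add_sub_cancel_left]
      _ ≤ ‖S.K t x + S.response H t M‖ + ‖S.K t x‖ := norm_sub_le _ _
      _ ≤ ‖S.proxyLin H t M‖ + κ * ‖S.proxyLin H t M‖ := by
          gcongr
          exact ContinuousLinearMap.le_of_opNorm_le_of_le _
            (hS.norm_K_le t (Finset.mem_Icc.2 ⟨hpos, ht⟩)) hx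
      _ = (1 + κ) * ‖S.proxyLin H t M‖ := by ring

end IsStableOn

end LTVProblem

namespace LTVProblem

variable {n m H : ℕ} (S : LTVProblem n m)

section Costs

/-- The pair of the state `x` and the control at time `t` with parameter `M`, at which costs are
evaluated. -/
noncomputable def pairAt (t : ℕ) (x : Vec n) (M : DRCParam n m H) : StateControl n m :=
  WithLp.toLp 2 (x, S.control t x M)

theorem pairAt_sub (t : ℕ) (x y : Vec n) (M : DRCParam n m H) :
    S.pairAt t x M - S.pairAt t y M = WithLp.toLp 2 (x - y, S.K t (x - y)) := by
  rw [pairAt, pairAt, ← WithLp.toLp_sub, Prod.mk_sub_mk, control, control, map_sub,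
    add_sub_add_right_eq_sub]

theorem pairAt_proxyState_const (t : ℕ) (M : DRCParam n m H) :
    S.pairAt t (S.proxyState (fun _ => M) t) M =
      S.pairAt t (S.proxyState (fun _ => (0 : DRCParam n m H)) t) (0 : DRCParam n m H)
        + S.proxyLin H t M := by
  rw [proxyLin_apply, pairAt, pairAt, ← WithLp.toLp_add, Prod.mk_add_mk, proxyState,
    S.stateFrom_const_eq_add_stateLin]
  simp only [control, map_add, map_zero, add_zero, proxyState]
  abel_nf

theorem surrogateLoss_eq (t : ℕ) (M : DRCParam n m H) :
    S.surrogateLoss t M = S.c t (S.pairAt t (S.proxyState (fun _ => M) t) M) := rfl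

/-- The gradient of `c_t` at the point at which `surrogateLoss t M` evaluates it. -/
noncomputable def proxyGradient (t : ℕ) (M : DRCParam n m H) : StateControl n m :=
  gradient (S.c t) (S.pairAt t (S.proxyState (fun _ => M) t) M)

theorem gradient_surrogateLoss {t : ℕ} (hc : Differentiable ℝ (S.c t)) (M : DRCParam n m H) :
    gradient (S.surrogateLoss t) M
      = ContinuousLinearMap.adjoint (S.proxyLin H t) (S.proxyGradient t M) := by
  refine (hasGradientAt_iff_hasFDerivAt.2 ?_).gradient
  have hpair : HasFDerivAt (fun M : DRCParam n m H => S.pairAt t (S.proxyState (fun _ => M) t) M)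
      (S.proxyLin H t) M := by
    rw [funext (S.pairAt_proxyState_const t)]
    exact (S.proxyLin H t).hasFDerivAt.const_add _
  refine HasFDerivAt.congr_fderiv (HasFDerivAt.comp (g := S.c t)
    (f := fun M : DRCParam n m H => S.pairAt t (S.proxyState (fun _ => M) t) M) M
    (hc _).hasFDerivAt hpair) ?_
  ext N
  simp only [ContinuousLinearMap.comp_apply, InnerProductSpace.toDual_apply_apply,
    ContinuousLinearMap.adjoint_inner_left, proxyGradient, inner_gradient_left]

/-- The assumptions on the stage costs over the horizon `T`. -/
structure HasRegularCosts (T : ℕ) (α L : ℝ) : Prop where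
  differentiable : ∀ t ∈ Finset.Icc 1 T, Differentiable ℝ (S.c t)
  strongConvex : ∀ t ∈ Finset.Icc 1 T, StrongConvexOn Set.univ α (S.c t)
  norm_gradient_le : ∀ t ∈ Finset.Icc 1 T, ∀ (x : Vec n) (u : Vec m),
    ‖gradient (S.c t) (WithLp.toLp 2 (x, u))‖ ≤ L * max 1 (‖x‖ + ‖u‖)

/-- A bound on the gradients of the costs along trajectories of disturbance response controls. -/
noncomputable def gradBound (W κ δ C_B γ L : ℝ) : ℝ :=
  L * max 1 (stateBound W κ δ C_B γ + (κ * stateBound W κ δ C_B γ + γ * natBound W κ δ))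

namespace HasRegularCosts

variable {S} {T : ℕ} {W κ δ C_B γ α L : ℝ} (hc : S.HasRegularCosts T α L)

include hc

theorem surrogateLoss_sub_le {t : ℕ} (ht : t ∈ Finset.Icc 1 T) (M N : DRCParam n m H) :
    S.surrogateLoss t M - S.surrogateLoss t N ≤
      inner ℝ (S.proxyGradient t M) (S.proxyLin H t (M - N))
        - α / 2 * ‖S.proxyLin H t (M - N)‖ ^ 2 := by
  have hfirst := strongConvexOn_univ_add_inner_gradient_le (hc.strongConvex t ht)
    (hc.differentiable t ht (S.pairAt t (S.proxyState (fun _ => M) t) M))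
    (S.pairAt t (S.proxyState (fun _ => N) t) N)
  have hpair : S.pairAt t (S.proxyState (fun _ => N) t) N
      - S.pairAt t (S.proxyState (fun _ => M) t) M = -S.proxyLin H t (M - N) := by
    rw [S.pairAt_proxyState_const t M, S.pairAt_proxyState_const t N, map_sub]
    abel
  rw [hpair, inner_neg_right, norm_neg] at hfirst
  rw [surrogateLoss_eq, surrogateLoss_eq, proxyGradient]
  linarith

variable (hS : S.IsStableOn T W κ δ C_B)

include hS

theorem L_nonneg : 0 ≤ L := by
  have h := (norm_nonneg _).trans (hc.norm_gradient_le 1 (by simpa using hS.one_le) 0 0)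
  exact nonneg_of_mul_nonneg_left h (lt_max_of_lt_left one_pos)

theorem gradBound_nonneg : 0 ≤ gradBound W κ δ C_B γ L :=
  mul_nonneg (hc.L_nonneg hS) (le_max_of_le_left zero_le_one)

theorem norm_gradient_pairAt_le {t : ℕ} (ht : t ∈ Finset.Icc 1 T) {x : Vec n}
    (hx : ‖x‖ ≤ stateBound W κ δ C_B γ) {M : DRCParam n m H}
    (hM : M ∈ DRCParam.constraintSet n m H γ) :
    ‖gradient (S.c t) (S.pairAt t x M)‖ ≤ gradBound W κ δ C_B γ L := by
  refine (hc.norm_gradient_le t ht x _).trans ?_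
  refine mul_le_mul_of_nonneg_left (max_le_max le_rfl ?_) (hc.L_nonneg hS)
  refine add_le_add hx ((norm_add_le _ _).trans (add_le_add ?_ ?_))
  · exact ContinuousLinearMap.le_of_opNorm_le_of_le _ (hS.norm_K_le t ht) hx
  · exact hS.norm_response_le_of_mem ((Finset.mem_Icc.1 ht).2.trans T.le_succ) hM

theorem norm_proxyGradient_le {t : ℕ} (ht : t ∈ Finset.Icc 1 T) {M : DRCParam n m H}
    (hM : M ∈ DRCParam.constraintSet n m H γ) :
    ‖S.proxyGradient t M‖ ≤ gradBound W κ δ C_B γ L :=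
  hc.norm_gradient_pairAt_le hS ht
    (hS.norm_stateFrom_le (fun _ => hM) (t - H) ((Finset.mem_Icc.1 ht).2.trans T.le_succ)) hM

theorem abs_cost_pairAt_sub_le (hα : 0 ≤ α) {t : ℕ} (ht : t ∈ Finset.Icc 1 T) {x y : Vec n}
    (hx : ‖x‖ ≤ stateBound W κ δ C_B γ) (hy : ‖y‖ ≤ stateBound W κ δ C_B γ)
    {M : DRCParam n m H} (hM : M ∈ DRCParam.constraintSet n m H γ) :
    |S.c t (S.pairAt t x M) - S.c t (S.pairAt t y M)|
      ≤ gradBound W κ δ C_B γ L * ((1 + κ) * ‖x - y‖) := by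
  have hconvex : ConvexOn ℝ Set.univ (S.c t) :=
    strongConvexOn_zero.1 ((hc.strongConvex t ht).mono hα)
  refine (abs_sub_le_mul_of_norm_gradient_le hconvex (hc.differentiable t ht)
    (hc.norm_gradient_pairAt_le hS ht hx hM) (hc.norm_gradient_pairAt_le hS ht hy hM)).trans
    (mul_le_mul_of_nonneg_left ?_ (hc.gradBound_nonneg hS))
  rw [S.pairAt_sub]
  refine (norm_toLp_two_prod_le _ _).trans ?_
  linarith [ContinuousLinearMap.le_of_opNorm_le _ (hS.norm_K_le t ht) (x - y)]

theorem abs_cost_sub_memoryLoss_le (hα : 0 ≤ α) {M : ℕ → DRCParam n m H}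
    (hM : ∀ t, M t ∈ DRCParam.constraintSet n m H γ) {t : ℕ} (ht : t ∈ Finset.Icc 1 T) :
    |S.cost M t - S.memoryLoss M t| ≤
      gradBound W κ δ C_B γ L * ((1 + κ) * ((1 + κ) * (1 - δ) ^ H * stateBound W κ δ C_B γ)) := by
  have hκ := hS.κ_nonneg
  have htT : t ≤ T + 1 := (Finset.mem_Icc.1 ht).2.trans T.le_succ
  refine (hc.abs_cost_pairAt_sub_le hS hα ht (hS.norm_stateFrom_le hM 0 htT)
    (hS.norm_stateFrom_le hM (t - H) htT) (hM t)).trans ?_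
  refine mul_le_mul_of_nonneg_left ?_ (hc.gradBound_nonneg hS)
  gcongr
  exact hS.norm_state_sub_proxyState_le hM htT

theorem sum_abs_cost_sub_memoryLoss_le (hα : 0 ≤ α) {M : ℕ → DRCParam n m H}
    (hM : ∀ t, M t ∈ DRCParam.constraintSet n m H γ) :
    ∑ t ∈ Finset.Icc 1 T, |S.cost M t - S.memoryLoss M t| ≤
      gradBound W κ δ C_B γ L * (1 + κ) ^ 2 * stateBound W κ δ C_B γ * (T * (1 - δ) ^ H) := by
  refine (Finset.sum_le_card_nsmul _ _ _ fun t ht =>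
    hc.abs_cost_sub_memoryLoss_le hS hα hM ht).trans_eq ?_
  rw [Nat.card_Icc, Nat.add_sub_cancel, nsmul_eq_mul]
  ring

end HasRegularCosts

end Costs

section SemiONS

variable {γ η lam : ℝ}

theorem semiONS_mem_and_isMinOn {t : ℕ} {M : DRCParam n m H}
    (hM : M ∈ DRCParam.constraintSet n m H γ) :
    S.semiONS γ η lam t M ∈ DRCParam.constraintSet n m H γ ∧
    IsMinOn (fun Z => inner ℝ (Z - S.newtonPoint η lam t M)
        (S.precond H lam t (Z - S.newtonPoint η lam t M)))
      (DRCParam.constraintSet n m H γ) (S.semiONS γ η lam t M) :=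
  Classical.epsilon_spec (p := fun N : DRCParam n m H =>
    N ∈ DRCParam.constraintSet n m H γ ∧
    IsMinOn (fun Z => inner ℝ (Z - S.newtonPoint η lam t M)
        (S.precond H lam t (Z - S.newtonPoint η lam t M)))
      (DRCParam.constraintSet n m H γ) N) <|
    DRCParam.isCompact_constraintSet.exists_isMinOn ⟨M, hM⟩
      (Continuous.continuousOn (by fun_prop))

theorem drcONS_one (M₁ : DRCParam n m H) : S.drcONS γ η lam M₁ 1 = M₁ := if_pos rfl

theorem drcONS_succ (M₁ : DRCParam n m H) {t : ℕ} (ht : 1 ≤ t) :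
    S.drcONS γ η lam M₁ (t + 1) = S.semiONS γ η lam t (S.drcONS γ η lam M₁ t) :=
  if_neg (Nat.one_le_iff_ne_zero.1 ht)

theorem drcONS_mem {M₁ : DRCParam n m H} (hM₁ : M₁ ∈ DRCParam.constraintSet n m H γ) (t : ℕ) :
    S.drcONS γ η lam M₁ t ∈ DRCParam.constraintSet n m H γ := by
  induction t with
  | zero => exact hM₁
  | succ t ih =>
    rcases Nat.eq_zero_or_pos t with rfl | ht
    · rwa [zero_add, drcONS_one]
    · rw [S.drcONS_succ M₁ ht]
      exact (S.semiONS_mem_and_isMinOn ih).1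

/-- The leverage `tr (Λ_t⁻¹ Y_tᵀ Y_t)` of round `t` of Semi-ONS, which controls both the regret and
the movement of the parameters. -/
noncomputable def proxyLeverage (H : ℕ) (lam : ℝ) (t : ℕ) : ℝ :=
  leverage (S.precond H lam t) (S.proxyLin H t)

theorem proxyLeverage_nonneg (H : ℕ) (hlam : 0 < lam) (t : ℕ) : 0 ≤ S.proxyLeverage H lam t :=
  leverage_nonneg (regGram_isPositive _ hlam.le t) (regGram_isInvertible _ hlam t) _

theorem sum_Icc_zero_proxyLeverage (H T : ℕ) (lam : ℝ) :
    ∑ t ∈ Finset.Icc 0 T, S.proxyLeverage H lam t =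
      ∑ t ∈ Finset.Icc 1 T, S.proxyLeverage H lam t := by
  have hzero : S.proxyLeverage H lam 0 = 0 := by
    rw [proxyLeverage, proxyLin_zero, leverage_zero_right]
  rw [← Finset.add_sum_Ioc_eq_sum_Icc (Nat.zero_le T), hzero, zero_add]
  rfl

theorem log_one_add_mul_sq_le {x T : ℝ} (hx : 0 ≤ x) (hT : 1 ≤ T) (H : ℕ) :
    Real.log (1 + T * (x * H ^ 2)) ≤ (1 + x) * (H + Real.log T) := by
  have hfactor : 1 + T * (x * H ^ 2) ≤ T * ((1 + x * H) * (1 + H)) := by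
    nlinarith [show 0 ≤ T * (H + x * H) by positivity]
  have hlog (a : ℝ) (ha : 0 ≤ a) : Real.log (1 + a) ≤ a := by
    linarith [Real.log_le_sub_one_of_pos (by positivity : 0 < 1 + a)]
  calc Real.log (1 + T * (x * H ^ 2)) ≤ Real.log (T * ((1 + x * H) * (1 + H))) :=
        Real.log_le_log (by positivity) hfactor
    _ = Real.log T + (Real.log (1 + x * H) + Real.log (1 + H)) := by
        rw [Real.log_mul (by positivity) (by positivity),
          Real.log_mul (by positivity) (by positivity)]
    _ ≤ Real.log T + (x * H + H) := by
        gcongr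
        · exact hlog _ (by positivity)
        · exact hlog _ (by positivity)
    _ ≤ (1 + x) * (H + Real.log T) := by
        nlinarith [mul_nonneg hx (Real.log_nonneg hT)]

theorem IsStableOn.sum_proxyLeverage_le {S : LTVProblem n m} {T : ℕ} {W κ δ C_B : ℝ}
    (hS : S.IsStableOn T W κ δ C_B) (hlam : 0 < lam) (H : ℕ) :
    ∑ t ∈ Finset.Icc 1 T, S.proxyLeverage H lam t ≤
      m * n * (1 + linBound W κ δ C_B ^ 2 / lam) * (H * (H + Real.log T)) := by
  have hdim : (Module.finrank ℝ (DRCParam n m H) : ℝ) = H * (m * n) := by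
    rw [finrank_euclideanSpace]
    simp
  have hR : T * (linBound W κ δ C_B * H) ^ 2 / lam =
      T * (linBound W κ δ C_B ^ 2 / lam * H ^ 2) := by ring
  refine (sum_leverage_regGram_le (S.proxyLin H) hlam fun t ht => hS.norm_proxyLin_le ht).trans ?_
  rw [hdim, hR]
  calc (H * (m * n) : ℝ) * Real.log (1 + T * (linBound W κ δ C_B ^ 2 / lam * H ^ 2))
      ≤ H * (m * n) * ((1 + linBound W κ δ C_B ^ 2 / lam) * (H + Real.log T)) := by
        gcongr
        exact log_one_add_mul_sq_le (by positivity) (mod_cast hS.one_le) H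
    _ = m * n * (1 + linBound W κ δ C_B ^ 2 / lam) * (H * (H + Real.log T)) := by ring

namespace HasRegularCosts

variable {S} {T : ℕ} {W κ δ C_B α L : ℝ} (hc : S.HasRegularCosts T α L)
  {M₁ : DRCParam n m H} (hM₁ : M₁ ∈ DRCParam.constraintSet n m H γ)

include hc hM₁

theorem isOnlineNewton_drcONS : IsOnlineNewton η lam (DRCParam.constraintSet n m H γ)
    (S.proxyLin H) (fun t => S.proxyGradient t (S.drcONS γ η lam M₁ t)) T
    (S.drcONS γ η lam M₁) where
  convex := DRCParam.convex_constraintSet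
  mem := S.drcONS_mem hM₁
  isMinOn t ht := by
    rw [← S.gradient_surrogateLoss (hc.differentiable t ht),
      S.drcONS_succ M₁ (Finset.mem_Icc.1 ht).1]
    exact (S.semiONS_mem_and_isMinOn (S.drcONS_mem hM₁ t)).2

variable (hS : S.IsStableOn T W κ δ C_B) (hlam : 0 < lam)

include hS hlam

theorem sum_surrogateLoss_sub_le (hη : 0 < η) (hα : 1 ≤ η * α) {M : DRCParam n m H}
    (hM : M ∈ DRCParam.constraintSet n m H γ) :
    ∑ t ∈ Finset.Icc 1 T, (S.surrogateLoss t (S.drcONS γ η lam M₁ t) - S.surrogateLoss t M) ≤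
      lam / (2 * η) * (4 * (n * γ ^ 2)) + η / 2 * (gradBound W κ δ C_B γ L ^ 2
        * ∑ t ∈ Finset.Icc 1 T, S.proxyLeverage H lam t) := by
  have hdiam : ‖M₁ - M‖ ^ 2 ≤ 4 * (n * γ ^ 2) := by
    have htri : ‖M₁ - M‖ ^ 2 ≤ (‖M₁‖ + ‖M‖) ^ 2 := by gcongr; exact norm_sub_le _ _
    linarith [sq_nonneg (‖M₁‖ - ‖M‖), DRCParam.norm_sq_le_of_mem_constraintSet hM₁,
      DRCParam.norm_sq_le_of_mem_constraintSet hM]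
  refine (Finset.sum_le_sum fun t ht => hc.surrogateLoss_sub_le ht _ M).trans
    (((hc.isOnlineNewton_drcONS hM₁).regret_le hlam hη hα hM).trans ?_)
  rw [drcONS_one]
  gcongr
  rw [Finset.mul_sum]
  refine Finset.sum_le_sum fun t ht => mul_le_mul_of_nonneg_right ?_
    (S.proxyLeverage_nonneg H hlam t)
  gcongr
  exact hc.norm_proxyGradient_le hS ht (S.drcONS_mem hM₁ t)

theorem norm_response_drcONS_sub_le (hη : 0 ≤ η) {s t : ℕ} (hs : s ∈ Finset.Ico (t - H) t)
    (ht : t ≤ T) :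
    ‖S.response H s (S.drcONS γ η lam M₁ s - S.drcONS γ η lam M₁ t)‖ ≤
      (1 + κ) * (η * gradBound W κ δ C_B γ L * ∑ j ∈ Finset.Ico (t - H) t,
        (S.proxyLeverage H lam s + S.proxyLeverage H lam j)) := by
  obtain ⟨hs₁, hs₂⟩ := Finset.mem_Ico.1 hs
  have hκ := hS.κ_nonneg
  have hG := hc.gradBound_nonneg hS (γ := γ)
  have hpair (j : ℕ) : 0 ≤ S.proxyLeverage H lam s + S.proxyLeverage H lam j :=
    add_nonneg (S.proxyLeverage_nonneg H hlam s) (S.proxyLeverage_nonneg H hlam j)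
  rcases Nat.eq_zero_or_pos s with rfl | hpos
  · have := Finset.sum_nonneg fun j (_ : j ∈ Finset.Ico (t - H) t) => hpair j
    rw [response_zero, norm_zero]
    positivity
  · refine (hS.norm_response_le_mul_norm_proxyLin (hs₂.le.trans ht) _).trans ?_
    gcongr
    refine ((hc.isOnlineNewton_drcONS hM₁).norm_apply_sub_le hlam hη (fun j hj =>
      hc.norm_proxyGradient_le hS hj (S.drcONS_mem hM₁ j)) hpos hs₂.le (by omega)).trans ?_
    gcongr
    exact Finset.sum_le_sum_of_subset_of_nonneg (Finset.Ico_subset_Ico_left hs₁)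
      fun j _ _ => hpair j

theorem abs_memoryLoss_sub_surrogateLoss_le (hα : 0 ≤ α) (hη : 0 ≤ η) {t : ℕ}
    (ht : t ∈ Finset.Icc 1 T) :
    |S.memoryLoss (S.drcONS γ η lam M₁) t - S.surrogateLoss t (S.drcONS γ η lam M₁ t)| ≤
      2 * η * C_B * (1 + κ) ^ 3 * gradBound W κ δ C_B γ L ^ 2 * H
        * ∑ s ∈ Finset.Ico (t - H) t, S.proxyLeverage H lam s := by
  have hκ := hS.κ_nonneg
  have hB := hS.C_B_nonneg
  have hG := hc.gradBound_nonneg hS (γ := γ)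
  have hM := S.drcONS_mem (η := η) (lam := lam) hM₁
  have htT : t ≤ T := (Finset.mem_Icc.1 ht).2
  set M := S.drcONS γ η lam M₁
  set G := gradBound W κ δ C_B γ L
  set q := S.proxyLeverage H lam
  have hdouble : ∑ s ∈ Finset.Ico (t - H) t, ∑ j ∈ Finset.Ico (t - H) t, (q s + q j)
      ≤ 2 * H * ∑ s ∈ Finset.Ico (t - H) t, q s := by
    have hcard : ((Finset.Ico (t - H) t).card : ℝ) ≤ H := by
      rw [Nat.card_Ico]
      exact_mod_cast tsub_tsub_le
    have hsum := Finset.sum_nonneg fun s (_ : s ∈ Finset.Ico (t - H) t) =>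
      S.proxyLeverage_nonneg H hlam s
    simp only [Finset.sum_add_distrib, Finset.sum_const, nsmul_eq_mul, ← Finset.mul_sum]
    linarith [mul_le_mul_of_nonneg_right hcard hsum]
  calc |S.memoryLoss M t - S.surrogateLoss t (M t)|
      ≤ G * ((1 + κ) * ‖S.stateFrom (t - H) M t - S.stateFrom (t - H) (fun _ => M t) t‖) :=
        hc.abs_cost_pairAt_sub_le hS hα ht (hS.norm_stateFrom_le hM _ (by omega))
          (hS.norm_stateFrom_le (fun _ => hM t) _ (by omega)) (hM t)
    _ ≤ G * ((1 + κ) * ((1 + κ) * ∑ s ∈ Finset.Ico (t - H) t,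
          C_B * ‖S.response H s (M s - M t)‖)) := by
        gcongr
        exact hS.norm_stateFrom_sub_le M (fun _ => M t) (Nat.sub_le t H) (by omega)
    _ ≤ G * ((1 + κ) * ((1 + κ) * ∑ s ∈ Finset.Ico (t - H) t,
          C_B * ((1 + κ) * (η * G * ∑ j ∈ Finset.Ico (t - H) t, (q s + q j))))) := by
        gcongr with s hs
        exact hc.norm_response_drcONS_sub_le hM₁ hS hlam hη hs htT
    _ = η * C_B * (1 + κ) ^ 3 * G ^ 2 *
          ∑ s ∈ Finset.Ico (t - H) t, ∑ j ∈ Finset.Ico (t - H) t, (q s + q j) := by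
        simp only [← Finset.mul_sum]
        ring
    _ ≤ η * C_B * (1 + κ) ^ 3 * G ^ 2 * (2 * H * ∑ s ∈ Finset.Ico (t - H) t, q s) := by gcongr
    _ = 2 * η * C_B * (1 + κ) ^ 3 * G ^ 2 * H * ∑ s ∈ Finset.Ico (t - H) t, q s := by ring

theorem stabilityGap_drcONS_le (hα : 0 ≤ α) (hη : 0 ≤ η) :
    S.stabilityGap T (S.drcONS γ η lam M₁) ≤
      2 * η * C_B * (1 + κ) ^ 3 * gradBound W κ δ C_B γ L ^ 2 * H ^ 2
        * ∑ t ∈ Finset.Icc 1 T, S.proxyLeverage H lam t := by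
  have hκ := hS.κ_nonneg
  have hB := hS.C_B_nonneg
  refine (Finset.sum_le_sum fun t ht =>
    hc.abs_memoryLoss_sub_surrogateLoss_le hM₁ hS hlam hα hη ht).trans ?_
  rw [← Finset.mul_sum, ← S.sum_Icc_zero_proxyLeverage, pow_two (H : ℝ), ← mul_assoc,
    mul_assoc _ (H : ℝ) (∑ t ∈ Finset.Icc 0 T, _)]
  gcongr
  exact sum_Icc_sum_Ico_sub_le (S.proxyLeverage_nonneg H hlam) H T

end HasRegularCosts

end SemiONS

theorem sum_cost_sub_sum_cost_const_le (T : ℕ) (M : ℕ → DRCParam n m H) (N : DRCParam n m H) :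
    ∑ t ∈ Finset.Icc 1 T, S.cost M t - ∑ t ∈ Finset.Icc 1 T, S.cost (fun _ => N) t ≤
      ∑ t ∈ Finset.Icc 1 T, |S.cost M t - S.memoryLoss M t|
        + S.stabilityGap T M
        + ∑ t ∈ Finset.Icc 1 T, (S.surrogateLoss t (M t) - S.surrogateLoss t N)
        + ∑ t ∈ Finset.Icc 1 T, |S.cost (fun _ => N) t - S.memoryLoss (fun _ => N) t| := by
  rw [stabilityGap, ← Finset.sum_sub_distrib, ← Finset.sum_add_distrib, ← Finset.sum_add_distrib,
    ← Finset.sum_add_distrib]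
  refine Finset.sum_le_sum fun t _ => ?_
  rw [show S.surrogateLoss t N = S.memoryLoss (fun _ => N) t from rfl]
  linarith [le_abs_self (S.cost M t - S.memoryLoss M t),
    le_abs_self (S.memoryLoss M t - S.surrogateLoss t (M t)),
    neg_abs_le (S.cost (fun _ => N) t - S.memoryLoss (fun _ => N) t)]

end LTVProblem

theorem pow_one_sub_le_inv {δ : ℝ} (hδ : δ ≤ 1) {T : ℝ} (hT : 0 < T) {H : ℕ}
    (hH : Real.log T ≤ δ * H) : (1 - δ) ^ H ≤ T⁻¹ := by
  calc (1 - δ) ^ H ≤ Real.exp (-δ) ^ H :=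
        pow_le_pow_left₀ (sub_nonneg.2 hδ) (Real.one_sub_le_exp_neg δ) H
    _ = Real.exp (-(δ * H)) := by rw [← Real.exp_nat_mul]; ring_nf
    _ ≤ Real.exp (-Real.log T) := by gcongr
    _ = T⁻¹ := by rw [Real.exp_neg, Real.exp_log hT]

/-- The rate, up to constants, of the regret and the stability gap of DRC-ONS with memory length
`H`. The last term is the price of truncating the dynamics to `H` rounds. -/
noncomputable def drcRate (δ : ℝ) (T H : ℕ) : ℝ :=
  1 + H ^ 3 * (H + Real.log T) + T * (1 - δ) ^ H

theorem one_le_drcRate {δ : ℝ} (hδ : δ ≤ 1) (T H : ℕ) : 1 ≤ drcRate δ T H := by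
  have := sub_nonneg.2 hδ
  have := Real.log_natCast_nonneg T
  rw [drcRate, add_assoc]
  exact le_add_of_nonneg_right (by positivity)

theorem pow_three_mul_le_drcRate {δ : ℝ} (hδ : δ ≤ 1) (T H : ℕ) :
    H ^ 3 * (H + Real.log T) ≤ drcRate δ T H := by
  have : 0 ≤ T * (1 - δ) ^ H := mul_nonneg T.cast_nonneg (pow_nonneg (sub_nonneg.2 hδ) H)
  unfold drcRate
  linarith

theorem mul_pow_one_sub_le_drcRate {δ : ℝ} (T H : ℕ) : T * (1 - δ) ^ H ≤ drcRate δ T H := by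
  have := Real.log_natCast_nonneg T
  exact le_add_of_nonneg_left (by positivity)

theorem drcRate_le {δ b : ℝ} (hδ : δ ≤ 1) {T H : ℕ} (hT : 2 ≤ T) (hlog : Real.log T ≤ δ * H)
    (hb : H ≤ b * Real.log T) : drcRate δ T H ≤ 4 * b ^ 4 * Real.log T ^ 4 := by
  have hT0 : (0 : ℝ) < T := by positivity
  have hpos : 0 < Real.log T := Real.log_pos (mod_cast hT)
  have hH : (1 : ℝ) ≤ H := by
    refine mod_cast Nat.one_le_iff_ne_zero.2 ?_
    rintro rfl
    simp only [Nat.cast_zero, mul_zero] at hlog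
    exact hpos.not_ge hlog
  have hlogH : Real.log T ≤ H := hlog.trans (mul_le_of_le_one_left H.cast_nonneg hδ)
  have htail : T * (1 - δ) ^ H ≤ 1 := by
    calc T * (1 - δ) ^ H ≤ T * (T : ℝ)⁻¹ := by
          gcongr
          exact pow_one_sub_le_inv hδ hT0 hlog
      _ = 1 := mul_inv_cancel₀ hT0.ne'
  calc drcRate δ T H ≤ (H : ℝ) ^ 4 + H ^ 3 * (H + H) + H ^ 4 := by
        unfold drcRate
        gcongr
        · exact one_le_pow₀ hH
        · exact htail.trans (one_le_pow₀ hH)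
    _ = 4 * (H : ℝ) ^ 4 := by ring
    _ ≤ 4 * (b * Real.log T) ^ 4 := by gcongr
    _ = 4 * b ^ 4 * Real.log T ^ 4 := by ring

namespace LTVProblem

variable {n m T : ℕ} {S : LTVProblem n m} {W κ δ C_B γ α L η lam : ℝ}

theorem IsStableOn.sq_mul_sum_proxyLeverage_le (hS : S.IsStableOn T W κ δ C_B) (hlam : 0 < lam)
    (H : ℕ) :
    H ^ 2 * ∑ t ∈ Finset.Icc 1 T, S.proxyLeverage H lam t ≤
      m * n * (1 + linBound W κ δ C_B ^ 2 / lam) * drcRate δ T H := by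
  calc H ^ 2 * ∑ t ∈ Finset.Icc 1 T, S.proxyLeverage H lam t
      ≤ H ^ 2 * (m * n * (1 + linBound W κ δ C_B ^ 2 / lam) * (H * (H + Real.log T))) := by
        gcongr
        exact hS.sum_proxyLeverage_le hlam H
    _ = m * n * (1 + linBound W κ δ C_B ^ 2 / lam) * (H ^ 3 * (H + Real.log T)) := by ring
    _ ≤ m * n * (1 + linBound W κ δ C_B ^ 2 / lam) * drcRate δ T H := by
        gcongr
        exact pow_three_mul_le_drcRate hS.δ_lt_one.le T H

theorem IsStableOn.sum_proxyLeverage_le_mul_drcRate (hS : S.IsStableOn T W κ δ C_B)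
    (hlam : 0 < lam) (H : ℕ) :
    ∑ t ∈ Finset.Icc 1 T, S.proxyLeverage H lam t ≤
      m * n * (1 + linBound W κ δ C_B ^ 2 / lam) * drcRate δ T H := by
  have := Real.log_natCast_nonneg T
  have hcube : (H : ℝ) ≤ H ^ 3 := mod_cast Nat.le_self_pow three_ne_zero H
  refine (hS.sum_proxyLeverage_le hlam H).trans ?_
  gcongr
  exact (mul_le_mul_of_nonneg_right hcube (by positivity)).trans
    (pow_three_mul_le_drcRate hS.δ_lt_one.le T H)

namespace HasRegularCosts

variable {H : ℕ} {M₁ : DRCParam n m H} (hc : S.HasRegularCosts T α L)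
  (hM₁ : M₁ ∈ DRCParam.constraintSet n m H γ) (hS : S.IsStableOn T W κ δ C_B) (hlam : 0 < lam)

include hc hM₁ hS hlam

theorem stabilityGap_drcONS_le_mul_drcRate (hα : 0 ≤ α) (hη : 0 ≤ η) :
    S.stabilityGap T (S.drcONS γ η lam M₁) ≤
      2 * η * C_B * (1 + κ) ^ 3 * gradBound W κ δ C_B γ L ^ 2
        * (m * n * (1 + linBound W κ δ C_B ^ 2 / lam)) * drcRate δ T H := by
  have hκ := hS.κ_nonneg
  have hB := hS.C_B_nonneg
  refine (hc.stabilityGap_drcONS_le hM₁ hS hlam hα hη).trans ?_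
  rw [mul_assoc _ ((H : ℝ) ^ 2), mul_assoc _ (_ * _) (drcRate δ T H)]
  exact mul_le_mul_of_nonneg_left (hS.sq_mul_sum_proxyLeverage_le hlam H) (by positivity)

theorem sum_cost_drcONS_sub_le_mul_drcRate (hα : 0 < α) (hη : 1 / α ≤ η) {M : DRCParam n m H}
    (hM : M ∈ DRCParam.constraintSet n m H γ) :
    ∑ t ∈ Finset.Icc 1 T, S.cost (S.drcONS γ η lam M₁) t
        - ∑ t ∈ Finset.Icc 1 T, S.cost (fun _ => M) t ≤
      S.stabilityGap T (S.drcONS γ η lam M₁)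
        + (2 * (gradBound W κ δ C_B γ L * (1 + κ) ^ 2 * stateBound W κ δ C_B γ)
          + lam / (2 * η) * (4 * (n * γ ^ 2))
          + η / 2 * (gradBound W κ δ C_B γ L ^ 2
            * (m * n * (1 + linBound W κ δ C_B ^ 2 / lam)))) * drcRate δ T H := by
  have hη0 : 0 < η := (one_div_pos.2 hα).trans_le hη
  have hκ := hS.κ_nonneg
  have hG := hc.gradBound_nonneg hS (γ := γ)
  have hX := hS.stateBound_nonneg (DRCParam.nonneg_of_mem_constraintSet hM₁)
  have htrunc (N : ℕ → DRCParam n m H) (hN : ∀ t, N t ∈ DRCParam.constraintSet n m H γ) :=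
    (hc.sum_abs_cost_sub_memoryLoss_le hS hα.le hN).trans
      (mul_le_mul_of_nonneg_left (mul_pow_one_sub_le_drcRate T H) (by positivity))
  have hdiam : lam / (2 * η) * (4 * (n * γ ^ 2)) ≤
      lam / (2 * η) * (4 * (n * γ ^ 2)) * drcRate δ T H :=
    le_mul_of_one_le_right (by positivity) (one_le_drcRate hS.δ_lt_one.le T H)
  have hnewton := mul_le_mul_of_nonneg_left (hS.sum_proxyLeverage_le_mul_drcRate hlam H)
    (by positivity : 0 ≤ η / 2 * gradBound W κ δ C_B γ L ^ 2)
  linarith [S.sum_cost_sub_sum_cost_const_le T (S.drcONS γ η lam M₁) M,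
    htrunc _ (S.drcONS_mem (η := η) (lam := lam) hM₁), htrunc _ fun _ => hM,
    hc.sum_surrogateLoss_sub_le hM₁ hS hlam hη0 ((div_le_iff₀ hα).1 hη) hM]

end HasRegularCosts

end LTVProblem

theorem mul_drcRate_le (C : ℝ) {δ b : ℝ} (hδ : δ ≤ 1) {T H : ℕ} (hT : 2 ≤ T)
    (hlog : Real.log T ≤ δ * H) (hb : H ≤ b * Real.log T) :
    C * drcRate δ T H ≤ |C| * (4 * b ^ 4) * Real.log T ^ 4 := by
  calc C * drcRate δ T H ≤ |C| * drcRate δ T H :=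
        mul_le_mul_of_nonneg_right (le_abs_self C) (zero_le_one.trans (one_le_drcRate hδ T H))
    _ ≤ |C| * (4 * b ^ 4 * Real.log T ^ 4) := by
        gcongr
        exact drcRate_le hδ hT hlog hb
    _ = |C| * (4 * b ^ 4) * Real.log T ^ 4 := (mul_assoc _ _ _).symm

theorem mainTheorem8_general (n m : ℕ) (W κ δ C_B γ : ℝ) {α : ℝ} (L : ℝ) {η lam : ℝ} (hα : 0 < α)
    (hη : 1 / α ≤ η) (hlam : 0 < lam) :
    ∃ C : ℝ, ∀ (T H : ℕ) (S : LTVProblem n m) (M₁ : DRCParam n m H),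
      S.IsStableOn T W κ δ C_B → S.HasRegularCosts T α L →
      M₁ ∈ DRCParam.constraintSet n m H γ →
      (∀ M ∈ DRCParam.constraintSet n m H γ,
        ∑ t ∈ Finset.Icc 1 T, S.cost (S.drcONS γ η lam M₁) t
          - ∑ t ∈ Finset.Icc 1 T, S.cost (fun _ => M) t ≤ C * drcRate δ T H) ∧
      S.stabilityGap T (S.drcONS γ η lam M₁) ≤ C * drcRate δ T H := by
  have hη0 : 0 < η := (one_div_pos.2 hα).trans_le hη
  let G := LTVProblem.gradBound W κ δ C_B γ L
  let Q : ℝ := m * n * (1 + LTVProblem.linBound W κ δ C_B ^ 2 / lam)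
  let gap := 2 * η * C_B * (1 + κ) ^ 3 * G ^ 2 * Q
  let rest := 2 * (G * (1 + κ) ^ 2 * LTVProblem.stateBound W κ δ C_B γ)
    + lam / (2 * η) * (4 * (n * γ ^ 2)) + η / 2 * (G ^ 2 * Q)
  refine ⟨gap + rest, fun T H S M₁ hS hc hM₁ => ?_⟩
  have hκ := hS.κ_nonneg
  have hG : 0 ≤ G := hc.gradBound_nonneg hS
  have hX := hS.stateBound_nonneg (DRCParam.nonneg_of_mem_constraintSet hM₁)
  have hrate : 0 ≤ drcRate δ T H := zero_le_one.trans (one_le_drcRate hS.δ_lt_one.le T H)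
  have hrest : 0 ≤ rest * drcRate δ T H := by positivity
  have hgap := hc.stabilityGap_drcONS_le_mul_drcRate hM₁ hS hlam hα.le hη0.le
  rw [add_mul]
  exact ⟨fun M hM => (hc.sum_cost_drcONS_sub_le_mul_drcRate hM₁ hS hlam hα hη hM).trans
    (add_le_add_left hgap _), hgap.trans (le_add_of_nonneg_right hrest)⟩

theorem mainTheorem8 :
    ∃ k : ℕ, ∀ (n m : ℕ) (W κ δ C_B γ α L η lam b : ℝ),
      0 < δ → δ < 1 → 0 < α → 1 / α ≤ η → 0 < lam →
      ∃ C : ℝ, ∀ (T H : ℕ), 2 ≤ T → Real.log T ≤ δ * H → H ≤ b * Real.log T →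
        ∀ (S : LTVProblem n m) (M₁ : DRCParam n m H),
          (∀ t ∈ Finset.Icc 0 T, ‖S.w t‖ ≤ W) →
          (∀ t ∈ Finset.Icc 1 T, ‖S.B t‖ ≤ C_B) →
          (∀ t ∈ Finset.Icc 1 T, ‖S.K t‖ ≤ κ) →
          S.SeqStabilizing T κ δ →
          (∀ t ∈ Finset.Icc 1 T, Differentiable ℝ (S.c t)) →
          (∀ t ∈ Finset.Icc 1 T, StrongConvexOn Set.univ α (S.c t)) →
          (∀ t ∈ Finset.Icc 1 T, ∀ (x : Vec n) (u : Vec m),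
            ‖gradient (S.c t) (WithLp.toLp 2 (x, u))‖ ≤ L * max 1 (‖x‖ + ‖u‖)) →
          M₁ ∈ DRCParam.constraintSet n m H γ →
          (∀ M ∈ DRCParam.constraintSet n m H γ,
            ∑ t ∈ Finset.Icc 1 T, S.cost (S.drcONS γ η lam M₁) t
              - ∑ t ∈ Finset.Icc 1 T, S.cost (fun _ => M) t ≤ C * Real.log T ^ k) ∧
          S.stabilityGap T (S.drcONS γ η lam M₁) ≤ C * Real.log T ^ k := by
  refine ⟨4, fun n m W κ δ C_B γ α L η lam b hδ hδ1 hα hη hlam => ?_⟩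
  obtain ⟨C, hC⟩ := mainTheorem8_general n m W κ δ C_B γ L hα hη hlam
  refine ⟨|C| * (4 * b ^ 4),
    fun T H hT hlog hb S M₁ hw hB hK hstab hdiff hconv hgrad hM₁ => ?_⟩
  have hrate := mul_drcRate_le C hδ1.le hT hlog hb
  obtain ⟨hregret, hgap⟩ := hC T H S M₁
    ⟨hδ, by omega, hw, hB, hK, hstab⟩ ⟨hdiff, hconv, hgrad⟩ hM₁
  exact ⟨fun M hM => (hregret M hM).trans hrate, hgap.trans hrate⟩
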